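/- Let $\mathcal{E}=\{x\in\mathbb{R} : |x|>1\}$. All functions are complex valued, and for an open set $U\subseteq\mathbb{R}$, $W^{1,2}(U)$ is the space of all $v\in L^2(U)$ with weak derivative $v'\in L^2(U)$, normed by $\|v\|_{W^{1,2}(U)}^2=\|v\|_{L^2(U)}^2+\|v'\|_{L^2(U)}^2$. For $f\in L^2(\mathbb{R})$ let $$(\mathcal{H}f)(x)=\frac1\pi\lim_{\varepsilon\to0+}\int_{|x-\tilde x|\ge\varepsilon}\frac{f(\tilde x)}{x-\tilde x}\,d\tilde x$$ (for almost every $x\in\mathbb{R}$) be its Hilbert transform, and for $u\in W^{1,2}(\mathbb{R})$ let $\Lambda_{\mathbb{H}}u=-\mathcal{H}u'$ be the Dirichlet-to-Neumann map of the upper half-plane. For $v:\mathcal{E}\to\mathbb{C}$ define $\eta(v)$ (almost everywhere) on $\mathbb{R}$ by $\eta(v)(x)=v(x)$ for $|x|>1$, $\eta(v)(x)=v(1/x)$ for $0<|x|<1$, and $\eta(v)(0)=0$. Let $V_0(\mathcal{E})$ be the space of those $v\in W^{1,2}(\mathcal{E})$ whose support is a compact subset of $\mathbb{R}$. For every $v\in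 V_0(\mathcal{E})$ one has $\eta(v)\in W^{1,2}(\mathbb{R})$, and the Dirichlet-to-Neumann map $\Lambda_\Omega$ of $\Omega=\{(x,y)\in\mathbb{R}^2: x^2+y^2>1,\ y>0\}$ is defined on $V_0(\mathcal{E})$ by $$(\Lambda_\Omega v)(x)=[\Lambda_{\mathbb{H}}(\eta(v))](x)\qquad\text{for almost every } x\in\mathcal{E}.$$ Then $\Lambda_\Omega$ extends, in a unique way, to a bounded linear operator, still denoted by $\Lambda_\Omega$, from $W^{1,2}(\mathcal{E})$ to $L^2(\mathcal{E})$. Moreover, for every $v\in W^{1,2}(\mathcal{E})$ and almost every $x\in\mathcal{E}$, the principal values defining $\mathcal{H}(g(v))$ at $x$ and at $1/x$ exist and $$(\Lambda_\Omega v)(x)=-(\mathcal{H}(g(v)))(x)-\frac1{x^2}(\mathcal{H}(g(v)))\left(\frac1x\right)-\frac{v(1)-v(-1)}{\pi x},$$ where $g(v)\in L^2(\mathbb{R})$ is the extension of $v'$ by zero outside $\mathcal{E}$, and $v(\pm1)$ are the values at $\pm1$ of the representative of $v$ that is continuous on $\{|x|\ge1\}$. -/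

import Mathlib

open MeasureTheory Filter Topology
open scoped ContDiff

noncomputable section

namespace FloatingDisk

/-- The free surface `ℰ = {x ∈ ℝ | |x| > 1}`. -/
def freeSurface : Set ℝ := {x | 1 < |x|}

/-- The space `L²(U)` of complex-valued functions, for `U ⊆ ℝ` with Lebesgue measure. -/
abbrev L2 (U : Set ℝ) : Type := Lp ℂ 2 ((volume : Measure ℝ).restrict U)

/-- `w` is the weak derivative of `v` on `U`: `∫_U v φ' = - ∫_U w φ` for all `φ ∈ C_c^∞(U)`. -/
def IsWeakDeriv (U : Set ℝ) (v w : L2 U) : Prop :=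
  ∀ φ : ℝ → ℂ, ContDiff ℝ ∞ φ → HasCompactSupport φ → tsupport φ ⊆ U →
    ∫ x in U, v x * deriv φ x = - ∫ x in U, w x * φ x

theorem integrable_mul_test {U : Set ℝ} (v : L2 U) {φ : ℝ → ℂ} (hφ : Continuous φ)
    (hc : HasCompactSupport φ) :
    Integrable (fun x => v x * φ x) ((volume : Measure ℝ).restrict U) :=
  (Lp.memLp v).integrable_mul (q := 2) (hφ.memLp_of_hasCompactSupport hc)

theorem IsWeakDeriv.add {U : Set ℝ} {v₁ w₁ v₂ w₂ : L2 U} (h₁ : IsWeakDeriv U v₁ w₁)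
    (h₂ : IsWeakDeriv U v₂ w₂) : IsWeakDeriv U (v₁ + v₂) (w₁ + w₂) := by
  intro φ hφ hc hs
  have hd : Continuous (deriv φ) := hφ.continuous_deriv (by simp)
  have e₁ : ∫ x in U, (v₁ + v₂ : L2 U) x * deriv φ x
      = (∫ x in U, v₁ x * deriv φ x) + ∫ x in U, v₂ x * deriv φ x := by
    rw [← integral_add (integrable_mul_test v₁ hd hc.deriv) (integrable_mul_test v₂ hd hc.deriv)]
    refine integral_congr_ae ?_
    filter_upwards [Lp.coeFn_add v₁ v₂] with x hx
    rw [hx, Pi.add_apply, add_mul]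
  have e₂ : ∫ x in U, (w₁ + w₂ : L2 U) x * φ x
      = (∫ x in U, w₁ x * φ x) + ∫ x in U, w₂ x * φ x := by
    rw [← integral_add (integrable_mul_test w₁ hφ.continuous hc)
      (integrable_mul_test w₂ hφ.continuous hc)]
    refine integral_congr_ae ?_
    filter_upwards [Lp.coeFn_add w₁ w₂] with x hx
    rw [hx, Pi.add_apply, add_mul]
  rw [e₁, e₂, h₁ φ hφ hc hs, h₂ φ hφ hc hs, neg_add]

theorem IsWeakDeriv.smul {U : Set ℝ} {v w : L2 U} (c : ℂ) (h : IsWeakDeriv U v w) :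
    IsWeakDeriv U (c • v) (c • w) := by
  intro φ hφ hc hs
  have e₁ : ∫ x in U, (c • v : L2 U) x * deriv φ x = c * ∫ x in U, v x * deriv φ x := by
    rw [← integral_const_mul]
    refine integral_congr_ae ?_
    filter_upwards [Lp.coeFn_smul c v] with x hx
    rw [hx, Pi.smul_apply, smul_eq_mul, mul_assoc]
  have e₂ : ∫ x in U, (c • w : L2 U) x * φ x = c * ∫ x in U, w x * φ x := by
    rw [← integral_const_mul]
    refine integral_congr_ae ?_
    filter_upwards [Lp.coeFn_smul c w] with x hx
    rw [hx, Pi.smul_apply, smul_eq_mul, mul_assoc]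
  rw [e₁, e₂, h φ hφ hc hs, mul_neg]

theorem IsWeakDeriv.zero (U : Set ℝ) : IsWeakDeriv U 0 0 := by
  have h : ∀ ψ : ℝ → ℂ, ∫ x in U, (0 : L2 U) x * ψ x = 0 := by
    intro ψ
    refine integral_eq_zero_of_ae ?_
    filter_upwards [Lp.coeFn_zero ℂ 2 ((volume : Measure ℝ).restrict U)] with x hx
    rw [hx, Pi.zero_apply, zero_mul]
  intro φ _ _ _
  rw [h, h, neg_zero]

/-- The Sobolev space `W^{1,2}(U)` for open `U ⊆ ℝ`. A function `v` is represented by the pair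
`(v, v')` of `v` and its (unique) weak derivative in `L²(U)`, so that the inherited norm is
`(‖v‖²_{L²(U)} + ‖v'‖²_{L²(U)})^{1/2}`. -/
def W12 (U : Set ℝ) : Submodule ℂ (WithLp 2 (L2 U × L2 U)) where
  carrier := {p | IsWeakDeriv U p.fst p.snd}
  add_mem' h₁ h₂ := IsWeakDeriv.add h₁ h₂
  zero_mem' := IsWeakDeriv.zero U
  smul_mem' c _ h := IsWeakDeriv.smul c h

/-- The underlying function of an element of `W^{1,2}(U)`. -/
def valFn {U : Set ℝ} (v : W12 U) : L2 U := (v : WithLp 2 (L2 U × L2 U)).fst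

/-- The weak derivative `v'` of an element of `W^{1,2}(U)`. -/
def weakDeriv {U : Set ℝ} (v : W12 U) : L2 U := (v : WithLp 2 (L2 U × L2 U)).snd

/-- The truncated integral `(1/π) ∫_{|x-t| ≥ ε} f(t) / (x-t) dt`. -/
def truncatedHilbert (f : ℝ → ℂ) (x ε : ℝ) : ℂ :=
  (1 / (Real.pi : ℂ)) * ∫ t in {t : ℝ | ε ≤ |x - t|}, f t / ((x : ℂ) - (t : ℂ))

/-- The principal value defining the Hilbert transform of `f` at `x` exists. -/
def HilbertExistsAt (f : ℝ → ℂ) (x : ℝ) : Prop :=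
  ∃ y : ℂ, Tendsto (truncatedHilbert f x) (𝓝[>] 0) (𝓝 y)

/-- The Hilbert transform `(ℋ f)(x) = (1/π) P.V. ∫ f(t) / (x-t) dt`
(meaningful at the points where `HilbertExistsAt f x`). -/
def hilbertTransform (f : ℝ → ℂ) (x : ℝ) : ℂ :=
  limUnder (𝓝[>] 0) (truncatedHilbert f x)

/-- The Dirichlet-to-Neumann map of the upper half-plane: `Λ_ℍ u = - ℋ u'`, `u ∈ W^{1,2}(ℝ)`. -/
def lambdaH (u : W12 Set.univ) (x : ℝ) : ℂ := - hilbertTransform (weakDeriv u) x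

/-- The extension `η(v)` of `v : ℰ → ℂ` to `ℝ` by inversion: `v(x)` for `|x| > 1`, `v(1/x)` for
`0 < |x| < 1` and `0` at `0`. (The values at the two points `±1` play no role.) -/
def eta (v : ℝ → ℂ) (x : ℝ) : ℂ :=
  if 1 < |x| then v x else if x = 0 then 0 else v (1 / x)

/-- `v ∈ V₀(ℰ)`: the (essential) support of `v ∈ W^{1,2}(ℰ)` is a compact subset of `ℝ`; it may
contain the points `±1`. -/
def MemV0 (v : W12 freeSurface) : Prop :=
  ∃ K : Set ℝ, IsCompact K ∧ ∀ᵐ x ∂(volume.restrict freeSurface), x ∉ K → valFn v x = 0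

/-- `f` is `Λ_Ω v` for `v ∈ V₀(ℰ)`: the function `η(v)` belongs to `W^{1,2}(ℝ)` and `f` is the
restriction of `Λ_ℍ (η(v))` to `ℰ` (where the principal value exists almost everywhere). -/
def IsLambdaOmega (v : W12 freeSurface) (f : L2 freeSurface) : Prop :=
  ∃ u : W12 Set.univ, (∀ᵐ x : ℝ, valFn u x = eta (valFn v) x) ∧
    ∀ᵐ x ∂(volume.restrict freeSurface),
      HilbertExistsAt (weakDeriv u) x ∧ f x = lambdaH u x

/-- `g(v)`: the extension of `v'` by zero outside `ℰ`. -/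
def gExt (v : W12 freeSurface) : ℝ → ℂ := freeSurface.indicator (weakDeriv v)

end FloatingDisk

end

open FloatingDisk

namespace FloatingDisk

/-! For `v` in V₀(ℰ), η(v) vanishes near 0 and its one-sided values agree at ±1, so it is an
indefinite integral. Its derivative is g + h, with g = `gExt v` carried by ℰ and h(t) = -t⁻² g(1/t)
carried by the interior of [-1, 1]. For |x| > 1 the Hilbert transform of h at x is an ordinary
integral. The substitution s = 1/t and the identity -s/(xs - 1) = -1/x + x⁻²/(1/x - s) turn it into
x⁻² (ℋg)(1/x) - (πx)⁻¹ ∫ g, and ∫ g = v(-1) - v(1). This is the formula on V₀(ℰ)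
(`tendsto_truncatedHilbert_hExt`, `MemV0.isLambdaOmega`).

Each term of the formula is bounded on W^{1,2}(ℰ): ℋ is bounded on L², f ↦ t⁻¹ f(1/t) is an isometry
of L² and x⁻² ≤ |x|⁻¹ on ℰ, the traces at ±1 are bounded functionals, and 1/x lies in L²(ℰ). So the
formula itself defines the operator (`exists_lambdaOmega`). Cutting off shows that V₀(ℰ) is dense
(`exists_seq_memV0_tendsto`), which gives uniqueness.

The analytic input is that principal values of f ∈ L²(ℝ) exist almost everywhere and agree with the
Fourier multiplier -i sgn ξ (`tendsto_truncatedHilbert`). No maximal inequality is used. The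
conjugate Poisson integral of f is the Poisson integral of ℋf, which converges at Lebesgue points of
ℋf. The conjugate Poisson kernel differs from the truncated kernel by an odd function dominated by
the Poisson kernel, whose effect vanishes at Lebesgue points of f. -/

/-! ### Poisson averages at Lebesgue points -/

theorem tendsto_inv_mul_setIntegral_norm_sub {f : ℝ → ℂ} {x : ℝ}
    (hx : Tendsto (fun r => ⨍ y in Metric.closedBall x r, ‖f y - f x‖) (𝓝[>] 0) (𝓝 0)) :
    Tendsto (fun r => r⁻¹ * ∫ y in Metric.closedBall x r, ‖f y - f x‖) (𝓝[>] 0) (𝓝 0) := by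
  have h2 := hx.const_mul 2
  rw [mul_zero] at h2
  refine h2.congr' ?_
  filter_upwards [self_mem_nhdsWithin] with r hr
  have hr' : (0 : ℝ) < r := hr
  rw [setAverage_eq, measureReal_def, Real.volume_closedBall, ENNReal.toReal_ofReal (by positivity),
    smul_eq_mul]
  field_simp

/-- Small radii are handled by the limit at the Lebesgue point. For larger ones, ‖f‖ ≤ ‖f‖² + 1
bounds the integral by the squared L² norm plus a multiple of r. The uniform bound later dominates a
dyadic series. -/
theorem exists_inv_mul_setIntegral_norm_sub_le {f : ℝ → ℂ} (hf : MemLp f 2 volume) {x : ℝ}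
    (hx : Tendsto (fun r => ⨍ y in Metric.closedBall x r, ‖f y - f x‖) (𝓝[>] 0) (𝓝 0)) :
    ∃ C : ℝ, ∀ r : ℝ, 0 < r → r⁻¹ * ∫ y in Metric.closedBall x r, ‖f y - f x‖ ≤ C := by
  have h1 := (tendsto_inv_mul_setIntegral_norm_sub hx).eventually (gt_mem_nhds one_pos)
  obtain ⟨δ, hδ, h1⟩ := mem_nhdsGT_iff_exists_Ioc_subset.1 h1
  have hδ : 0 < δ := hδ
  have hsq := (memLp_two_iff_integrable_sq_norm hf.1).1 hf
  set S : ℝ := ∫ y, ‖f y‖ ^ 2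
  have hS : 0 ≤ S := integral_nonneg fun y => by positivity
  refine ⟨1 + (δ⁻¹ * S + (1 + ‖f x‖) * 2), fun r hr => ?_⟩
  rcases le_or_gt r δ with h | h
  · have : r⁻¹ * ∫ y in Metric.closedBall x r, ‖f y - f x‖ < 1 := h1 ⟨hr, h⟩
    have : 0 ≤ δ⁻¹ * S + (1 + ‖f x‖) * 2 := by positivity
    linarith
  · have hb : ∫ y in Metric.closedBall x r, ‖f y - f x‖
        ≤ ∫ y in Metric.closedBall x r, (‖f y‖ ^ 2 + (1 + ‖f x‖)) := by
      refine integral_mono_of_nonneg (Eventually.of_forall fun y => norm_nonneg _) ?_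
        (Eventually.of_forall fun y => ?_)
      · refine hsq.integrableOn.add ?_
        exact integrableOn_const measure_closedBall_lt_top.ne
      · have := norm_sub_le (f y) (f x)
        have := sq_nonneg (‖f y‖ - 1)
        have := norm_nonneg (f y)
        simp only
        nlinarith
    rw [integral_add hsq.integrableOn (integrableOn_const measure_closedBall_lt_top.ne),
      setIntegral_const, measureReal_def, Real.volume_closedBall,
      ENNReal.toReal_ofReal (by positivity), smul_eq_mul] at hb
    have hs : ∫ y in Metric.closedBall x r, ‖f y‖ ^ 2 ≤ S :=
      setIntegral_le_integral hsq (Eventually.of_forall fun y => by positivity)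
    calc r⁻¹ * ∫ y in Metric.closedBall x r, ‖f y - f x‖
        ≤ r⁻¹ * (S + 2 * r * (1 + ‖f x‖)) := by gcongr; linarith
      _ = r⁻¹ * S + (1 + ‖f x‖) * 2 := by field_simp
      _ ≤ δ⁻¹ * S + (1 + ‖f x‖) * 2 := by gcongr
      _ ≤ _ := by linarith

/-- Dyadic decomposition: if 2^(k-1) ε ≤ |s| ≤ 2^k ε, the kernel is at most ε / (2^(k-1) ε)², which
is the stated bound; k = 0 covers |s| ≤ ε. -/
theorem exists_poisson_le {ε : ℝ} (hε : 0 < ε) (s : ℝ) :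
    ∃ k : ℕ, |s| ≤ 2 ^ k * ε ∧ ε / (s ^ 2 + ε ^ 2) ≤ 4 * (1 / 4) ^ k / ε := by
  rcases le_or_gt |s| ε with h | h
  · refine ⟨0, by simpa using h, ?_⟩
    rw [div_le_div_iff₀ (by positivity) hε]
    nlinarith [sq_nonneg s, sq_nonneg ε]
  · obtain ⟨n, h1, h2⟩ := exists_nat_pow_near (x := |s| / ε) (y := 2)
      ((one_le_div hε).2 h.le) one_lt_two
    rw [le_div_iff₀ hε] at h1
    rw [div_lt_iff₀ hε] at h2
    refine ⟨n + 1, h2.le, ?_⟩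
    have h3 : (2 ^ n * ε) ^ 2 ≤ s ^ 2 := by
      rw [← sq_abs s]; gcongr
    have h4 : (4 : ℝ) ^ n = (2 ^ n) ^ 2 := by rw [← pow_mul, mul_comm, pow_mul]; norm_num
    have h5 : (4 : ℝ) * (1 / 4) ^ (n + 1) / ε = ε / (2 ^ n * ε) ^ 2 := by
      rw [mul_pow, ← h4, pow_succ, div_pow, one_pow]; field_simp
    rw [h5]
    gcongr
    nlinarith [sq_nonneg ε]

/-- The kernel lies below a sum of multiples of indicators of balls of radius 2^k ε. Integrating
gives ∑ 4 · 2⁻ᵏ A(2^k ε), where A(r) is r⁻¹ times the oscillation integral over the ball of radius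
r. Every term tends to 0 and a geometric series dominates. -/
theorem tendsto_integral_poisson_norm_sub {f : ℝ → ℂ} (hf : MemLp f 2 volume) {x : ℝ}
    (hx : Tendsto (fun r => ⨍ y in Metric.closedBall x r, ‖f y - f x‖) (𝓝[>] 0) (𝓝 0)) :
    Tendsto (fun ε : ℝ => ∫ t, ε / ((x - t) ^ 2 + ε ^ 2) * ‖f t - f x‖) (𝓝[>] 0) (𝓝 0) := by
  set A : ℝ → ℝ := fun r => r⁻¹ * ∫ y in Metric.closedBall x r, ‖f y - f x‖ with hA
  have hA0 := tendsto_inv_mul_setIntegral_norm_sub hx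
  obtain ⟨C, hC⟩ := exists_inv_mul_setIntegral_norm_sub_le hf hx
  have hApos : ∀ r, 0 < r → 0 ≤ A r := fun r hr =>
    mul_nonneg (inv_nonneg.2 hr.le) (integral_nonneg fun _ => norm_nonneg _)
  have hgeo : Summable fun k : ℕ => 4 * (1 / 2 : ℝ) ^ k * C :=
    ((summable_geometric_of_lt_one (by norm_num) (by norm_num)).mul_left 4).mul_right C
  have hsum : Tendsto (fun ε : ℝ => ∑' k : ℕ, 4 * (1 / 2 : ℝ) ^ k * A (2 ^ k * ε)) (𝓝[>] 0)
      (𝓝 (∑' _ : ℕ, (0 : ℝ))) := by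
    refine tendsto_tsum_of_dominated_convergence hgeo (fun k => ?_) ?_
    · have h1 : Tendsto (fun ε : ℝ => 2 ^ k * ε) (𝓝[>] 0) (𝓝[>] 0) := by
        refine tendsto_nhdsWithin_iff.2 ⟨?_, ?_⟩
        · have : Tendsto (fun ε : ℝ => 2 ^ k * ε) (𝓝 0) (𝓝 (2 ^ k * 0)) :=
            tendsto_id.const_mul _
          rw [mul_zero] at this
          exact this.mono_left nhdsWithin_le_nhds
        · filter_upwards [self_mem_nhdsWithin] with ε hε
          have : (0 : ℝ) < ε := hε
          exact Set.mem_Ioi.2 (by positivity)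
      have h3 := (hA0.comp h1).const_mul (4 * (1 / 2 : ℝ) ^ k)
      rw [mul_zero] at h3
      exact h3
    · filter_upwards [self_mem_nhdsWithin] with ε hε k
      have : (0 : ℝ) < ε := hε
      have h2 : 0 < 2 ^ k * ε := by positivity
      rw [Real.norm_of_nonneg (mul_nonneg (by positivity) (hApos _ h2))]
      gcongr
      exact hC _ h2
  rw [tsum_zero] at hsum
  refine squeeze_zero' ?_ ?_ hsum
  · filter_upwards [self_mem_nhdsWithin] with ε hε
    have : (0 : ℝ) < ε := hε
    exact integral_nonneg fun t => by positivity
  filter_upwards [self_mem_nhdsWithin] with ε hε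
  have hε : (0 : ℝ) < ε := hε
  set B : ℕ → Set ℝ := fun k => Metric.closedBall x (2 ^ k * ε)
  set F : ℕ → ℝ → ℝ := fun k => (B k).indicator fun t => 4 * (1 / 4) ^ k / ε * ‖f t - f x‖ with hF
  have hBm : ∀ k, MeasurableSet (B k) := fun k => Metric.isClosed_closedBall.measurableSet
  have hFn : ∀ k t, 0 ≤ F k t := fun k t => Set.indicator_nonneg (fun t _ => by positivity) t
  have hFi : ∀ k, Integrable (F k) := by
    intro k
    refine (integrable_indicator_iff (hBm k)).2 (Integrable.const_mul ?_ _)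
    refine (Integrable.sub ?_ ?_).norm
    · exact (hf.locallyIntegrable (by norm_num)).integrableOn_isCompact (isCompact_closedBall _ _)
    · exact integrableOn_const measure_closedBall_lt_top.ne
  have hFint : ∀ k, ∫ t, F k t = 4 * (1 / 2 : ℝ) ^ k * A (2 ^ k * ε) := by
    intro k
    rw [integral_indicator (hBm k), integral_const_mul, hA]
    simp only [B]
    have : (1 / 4 : ℝ) ^ k = (1 / 2) ^ k * (2 ^ k)⁻¹ := by
      rw [← inv_pow, ← mul_pow]; norm_num
    rw [this, mul_inv]
    ring
  have hsm : Summable fun k => ∫ t, ‖F k t‖ := by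
    refine Summable.of_nonneg_of_le (fun k => integral_nonneg fun t => norm_nonneg _) (fun k => ?_) hgeo
    simp_rw [Real.norm_of_nonneg (hFn k _)]
    rw [hFint]
    gcongr
    exact hC _ (by positivity)
  have hFs : ∀ t, Summable fun k => F k t := by
    intro t
    refine Summable.of_nonneg_of_le (fun k => hFn k t)
      (g := fun k => F k t) (f := fun k => 4 * (1 / 4) ^ k / ε * ‖f t - f x‖) (fun k => ?_) ?_
    · exact Set.indicator_le_self' (fun t _ => by positivity) t
    · exact (((summable_geometric_of_lt_one (by norm_num) (by norm_num)).mul_left 4).div_const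
        ε).mul_right _
  have hgi : Integrable fun t => ∑' k, F k t := by
    refine ⟨?_, ?_⟩
    · refine aestronglyMeasurable_of_tendsto_ae atTop
        (f := fun n t => ∑ k ∈ Finset.range n, F k t) (fun n => ?_)
        (Eventually.of_forall fun t => (hFs t).hasSum.tendsto_sum_nat)
      exact Finset.aestronglyMeasurable_fun_sum _ fun k _ => (hFi k).1
    · calc ∫⁻ t, ‖∑' k, F k t‖ₑ ≤ ∫⁻ t, ∑' k, ‖F k t‖ₑ := lintegral_mono fun t =>
            enorm_tsum_le_tsum_enorm
        _ = ∑' k, ∫⁻ t, ‖F k t‖ₑ := lintegral_tsum fun k => (hFi k).1.enorm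
        _ = ∑' k, ENNReal.ofReal (∫ t, ‖F k t‖) := by
            simp_rw [ofReal_integral_norm_eq_lintegral_enorm (hFi _)]
        _ < ⊤ := lt_top_iff_ne_top.2 hsm.tsum_ofReal_ne_top
  rw [← tsum_congr hFint, integral_tsum_of_summable_integral_norm hFi hsm]
  refine integral_mono_of_nonneg (Eventually.of_forall fun t => by positivity) hgi
    (Eventually.of_forall fun t => ?_)
  obtain ⟨k, hk1, hk2⟩ := exists_poisson_le hε (x - t)
  refine le_trans ?_ ((hFs t).le_tsum k fun j _ => hFn j t)
  have htB : t ∈ B k := by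
    rw [Metric.mem_closedBall, Real.dist_eq, abs_sub_comm]; exact hk1
  simp only [hF, Set.indicator_of_mem htB]
  gcongr

/-! ### The Hilbert transform on L² as a Fourier multiplier -/

open FourierTransform

theorem continuous_integral_mul {μ : Measure ℝ} {k : ℝ → ℂ} (hk : MemLp k 2 μ) :
    Continuous fun h : Lp ℂ 2 μ => ∫ t, h t * k t ∂μ := by
  have : (fun h : Lp ℂ 2 μ => ∫ t, h t * k t ∂μ) = fun h =>
      ((ContinuousLinearMap.mul ℂ ℂ).lpPairing μ 2 2).flip (hk.toLp k) h := by
    funext h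
    rw [ContinuousLinearMap.flip_apply, ContinuousLinearMap.lpPairing_eq_integral]
    refine integral_congr_ae ?_
    filter_upwards [hk.coeFn_toLp] with t ht
    rw [ht]; rfl
  rw [this]
  exact ContinuousLinearMap.continuous _

/-- The multiplication formula for the Fourier transform on `L²(ℝ)`. -/
theorem integral_fourier_mul (h : Lp ℂ 2 (volume : Measure ℝ)) {m : ℝ → ℂ} (hm : Integrable m)
    (hm2 : MemLp m 2 volume) (hK : MemLp (𝓕 m) 2 volume) :
    ∫ ξ, (𝓕 h : Lp ℂ 2 (volume : Measure ℝ)) ξ * m ξ = ∫ t, h t * 𝓕 m t := by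
  have hc : Continuous fun h : Lp ℂ 2 (volume : Measure ℝ) => 𝓕 h :=
    (Lp.fourierTransformₗᵢ ℝ ℂ).continuous
  refine congrFun (DenseRange.equalizer
    (SchwartzMap.denseRange_toLpCLM (E := ℝ) (F := ℂ) (p := 2) (μ := volume) (by simp))
    ((continuous_integral_mul hm2).comp hc) (continuous_integral_mul hK) ?_) h
  funext f
  simp only [Function.comp_apply, SchwartzMap.toLpCLM_apply, SchwartzMap.toLp_fourier_eq]
  have e1 : ∫ ξ, (𝓕 f).toLp 2 volume ξ * m ξ = ∫ ξ, 𝓕 (f : ℝ → ℂ) ξ * m ξ := by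
    refine integral_congr_ae ?_
    filter_upwards [(𝓕 f).coeFn_toLp 2 volume] with ξ hξ
    rw [hξ, SchwartzMap.fourier_coe]
  have e2 : ∫ t, f.toLp 2 volume t * 𝓕 m t = ∫ t, f t * 𝓕 m t := by
    refine integral_congr_ae ?_
    filter_upwards [f.coeFn_toLp 2 volume] with ξ hξ
    rw [hξ]
  rw [e1, e2]
  simpa using! (VectorFourier.integral_fourierIntegral_smul_eq_flip (L := innerₗ ℝ)
    Real.continuous_fourierChar continuous_inner f.integrable hm)

theorem re_two_pi_mul (a b : ℝ) :
    (2 * (Real.pi : ℂ) * ((a : ℂ) + (b : ℂ) * Complex.I)).re = 2 * Real.pi * a := by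
  simp

/-- The half-line exponentials whose Fourier transforms are the Cauchy kernels. -/
noncomputable def expRight (ε x : ℝ) : ℝ → ℂ := (Set.Ioi 0).indicator fun ξ =>
  Complex.exp (2 * Real.pi * ((-ε : ℝ) + (x : ℂ) * Complex.I) * ξ)

/-- See `expRight`. -/
noncomputable def expLeft (ε x : ℝ) : ℝ → ℂ := (Set.Iic 0).indicator fun ξ =>
  Complex.exp (2 * Real.pi * ((ε : ℝ) + (x : ℂ) * Complex.I) * ξ)

/-- Squaring the modulus doubles the exponent, so square integrability is integrability at rate `2 *
a`. -/
theorem memLp_two_of_indicator_exp {s : Set ℝ} (hs : MeasurableSet s) (a : ℂ)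
    (h : IntegrableOn (fun x : ℝ => Complex.exp (2 * a * x)) s) :
    MemLp (s.indicator fun x : ℝ => Complex.exp (a * x)) 2 volume := by
  have hmeas : AEStronglyMeasurable (s.indicator fun x : ℝ => Complex.exp (a * x)) volume :=
    (Continuous.aestronglyMeasurable (by fun_prop)).indicator hs
  refine (memLp_two_iff_integrable_sq_norm hmeas).2 ?_
  refine ((integrable_indicator_iff hs).2 h).norm.congr (Eventually.of_forall fun x => ?_)
  by_cases hx : x ∈ s
  · simp only [Set.indicator_of_mem hx]
    rw [← norm_pow, ← Complex.exp_nat_mul]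
    push_cast; ring_nf
  · simp [Set.indicator_of_notMem hx]

theorem integrable_expRight {ε : ℝ} (hε : 0 < ε) (x : ℝ) : Integrable (expRight ε x) := by
  refine (integrable_indicator_iff measurableSet_Ioi).2 (integrableOn_exp_mul_complex_Ioi ?_ 0)
  rw [re_two_pi_mul]; nlinarith [Real.pi_pos]

theorem integrable_expLeft {ε : ℝ} (hε : 0 < ε) (x : ℝ) : Integrable (expLeft ε x) := by
  refine (integrable_indicator_iff measurableSet_Iic).2 (integrableOn_exp_mul_complex_Iic ?_ 0)
  rw [re_two_pi_mul]; nlinarith [Real.pi_pos]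

theorem memLp_expRight {ε : ℝ} (hε : 0 < ε) (x : ℝ) : MemLp (expRight ε x) 2 volume := by
  refine memLp_two_of_indicator_exp measurableSet_Ioi _ (integrableOn_exp_mul_complex_Ioi ?_ 0)
  rw [Complex.mul_re, re_two_pi_mul]
  simp only [Complex.re_ofNat, Complex.im_ofNat, zero_mul, sub_zero]
  nlinarith [Real.pi_pos, mul_pos Real.pi_pos hε]

theorem memLp_expLeft {ε : ℝ} (hε : 0 < ε) (x : ℝ) : MemLp (expLeft ε x) 2 volume := by
  refine memLp_two_of_indicator_exp measurableSet_Iic _ (integrableOn_exp_mul_complex_Iic ?_ 0)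
  rw [Complex.mul_re, re_two_pi_mul]
  simp only [Complex.re_ofNat, Complex.im_ofNat, zero_mul, sub_zero]
  positivity

theorem fourier_expRight {ε : ℝ} (hε : 0 < ε) (x t : ℝ) :
    𝓕 (expRight ε x) t = 1 / (2 * Real.pi * (ε - ((x : ℂ) - t) * Complex.I)) := by
  have h1 : ∀ ξ : ℝ, Complex.exp (↑(-2 * Real.pi * ξ * t) * Complex.I) • expRight ε x ξ
      = (Set.Ioi 0).indicator (fun ξ : ℝ => Complex.exp
        (2 * Real.pi * ((-ε : ℝ) + ((x - t : ℝ) : ℂ) * Complex.I) * ξ)) ξ := by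
    intro ξ
    by_cases hξ : ξ ∈ Set.Ioi (0 : ℝ)
    · simp only [expRight, Set.indicator_of_mem hξ, smul_eq_mul]
      rw [← Complex.exp_add]; push_cast; ring_nf
    · simp [expRight, Set.indicator_of_notMem hξ]
  rw [Real.fourier_real_eq_integral_exp_smul, integral_congr_ae (Eventually.of_forall h1),
    integral_indicator measurableSet_Ioi, integral_exp_mul_complex_Ioi]
  · rw [Complex.ofReal_zero, mul_zero, Complex.exp_zero, ← neg_div_neg_eq, neg_neg]
    push_cast; ring_nf
  · rw [re_two_pi_mul]; nlinarith [Real.pi_pos]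

theorem fourier_expLeft {ε : ℝ} (hε : 0 < ε) (x t : ℝ) :
    𝓕 (expLeft ε x) t = 1 / (2 * Real.pi * (ε + ((x : ℂ) - t) * Complex.I)) := by
  have h1 : ∀ ξ : ℝ, Complex.exp (↑(-2 * Real.pi * ξ * t) * Complex.I) • expLeft ε x ξ
      = (Set.Iic 0).indicator (fun ξ : ℝ => Complex.exp
        (2 * Real.pi * ((ε : ℝ) + ((x - t : ℝ) : ℂ) * Complex.I) * ξ)) ξ := by
    intro ξ
    by_cases hξ : ξ ∈ Set.Iic (0 : ℝ)
    · simp only [expLeft, Set.indicator_of_mem hξ, smul_eq_mul]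
      rw [← Complex.exp_add]; push_cast; ring_nf
    · simp [expLeft, Set.indicator_of_notMem hξ]
  rw [Real.fourier_real_eq_integral_exp_smul, integral_congr_ae (Eventually.of_forall h1),
    integral_indicator measurableSet_Iic, integral_exp_mul_complex_Iic]
  · rw [Complex.ofReal_zero, mul_zero, Complex.exp_zero]
    push_cast; ring_nf
  · rw [re_two_pi_mul]; nlinarith [Real.pi_pos]

theorem integrable_poisson {ε : ℝ} (hε : 0 < ε) (x : ℝ) :
    Integrable fun t : ℝ => ε / ((x - t) ^ 2 + ε ^ 2) := by
  have h := ((integrable_inv_one_add_sq.comp_mul_left' (inv_ne_zero hε.ne')).comp_sub_left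
    x).const_mul ε⁻¹
  refine h.congr (Eventually.of_forall fun t => ?_)
  simp only
  field_simp
  ring

theorem integral_poisson {ε : ℝ} (hε : 0 < ε) (x : ℝ) :
    ∫ t : ℝ, ε / ((x - t) ^ 2 + ε ^ 2) = Real.pi := by
  have h1 : ∀ t : ℝ, ε / ((x - t) ^ 2 + ε ^ 2) = ε⁻¹ * (1 + (ε⁻¹ * (x - t)) ^ 2)⁻¹ := by
    intro t; field_simp; ring
  simp_rw [h1]
  rw [integral_const_mul, integral_sub_left_eq_self (fun s => (1 + (ε⁻¹ * s) ^ 2)⁻¹) volume x,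
    Measure.integral_comp_mul_left (fun s => (1 + s ^ 2)⁻¹), integral_univ_inv_one_add_sq, inv_inv,
    abs_of_pos hε, smul_eq_mul]
  field_simp

/-- The squared modulus is a constant multiple of the Poisson kernel. The sign σ treats both
half-lines at once. -/
theorem memLp_cauchyKernel {ε : ℝ} (hε : 0 < ε) (x : ℝ) {σ : ℂ} (hσ : σ = 1 ∨ σ = -1) :
    MemLp (fun t : ℝ => 1 / (2 * Real.pi * (ε + σ * (((x : ℂ) - t) * Complex.I)))) 2 volume := by
  have hne : ∀ t : ℝ, (ε + σ * (((x : ℂ) - t) * Complex.I)) ≠ 0 := by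
    intro t h
    have := congrArg Complex.re h
    rcases hσ with rfl | rfl <;> simp at this <;> exact hε.ne' this
  have hcont : Continuous fun t : ℝ =>
      1 / (2 * Real.pi * (ε + σ * (((x : ℂ) - t) * Complex.I))) := by
    refine Continuous.div (by fun_prop) (by fun_prop) fun t => ?_
    refine mul_ne_zero ?_ (hne t)
    simp [Real.pi_ne_zero]
  refine (memLp_two_iff_integrable_sq_norm hcont.aestronglyMeasurable).2 ?_
  refine ((integrable_poisson hε x).const_mul ((2 * Real.pi) ^ 2 * ε)⁻¹).congr
    (Eventually.of_forall fun t => ?_)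
  have hn : ‖(ε + σ * (((x : ℂ) - t) * Complex.I))‖ ^ 2 = (x - t) ^ 2 + ε ^ 2 := by
    rw [← Complex.normSq_eq_norm_sq, Complex.normSq_apply]
    rcases hσ with rfl | rfl <;> simp <;> ring
  simp only
  rw [norm_div, norm_mul, norm_one, div_pow, mul_pow _ ‖_‖, hn, norm_mul, Complex.norm_real,
    Real.norm_of_nonneg Real.pi_pos.le, Complex.norm_ofNat]
  field_simp

theorem memLp_fourier_expRight {ε : ℝ} (hε : 0 < ε) (x : ℝ) :
    MemLp (𝓕 (expRight ε x)) 2 volume := by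
  refine (memLp_cauchyKernel hε x (Or.inr rfl)).ae_eq (Eventually.of_forall fun t => ?_)
  simp only [fourier_expRight hε]; ring_nf

theorem memLp_fourier_expLeft {ε : ℝ} (hε : 0 < ε) (x : ℝ) :
    MemLp (𝓕 (expLeft ε x)) 2 volume := by
  refine (memLp_cauchyKernel hε x (Or.inl rfl)).ae_eq (Eventually.of_forall fun t => ?_)
  simp only [fourier_expLeft hε]; ring_nf

/-- The two Cauchy kernels are complex conjugates, so their sum is twice the real part: the Poisson
kernel. -/
theorem fourier_expRight_add {ε : ℝ} (hε : 0 < ε) (x t : ℝ) :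
    𝓕 (expRight ε x) t + 𝓕 (expLeft ε x) t
      = (1 / Real.pi : ℂ) * ((ε / ((x - t) ^ 2 + ε ^ 2) : ℝ) : ℂ) := by
  have hp : (Real.pi : ℂ) ≠ 0 := by simp [Real.pi_ne_zero]
  have h1 : (ε - ((x : ℂ) - t) * Complex.I) ≠ 0 :=
    fun h => hε.ne' (by simpa using congrArg Complex.re h)
  have h2 : (ε + ((x : ℂ) - t) * Complex.I) ≠ 0 :=
    fun h => hε.ne' (by simpa using congrArg Complex.re h)
  have h3 : ((x : ℂ) - t) ^ 2 + (ε : ℂ) ^ 2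
      = (ε - ((x : ℂ) - t) * Complex.I) * (ε + ((x : ℂ) - t) * Complex.I) := by
    linear_combination (((x : ℂ) - t) ^ 2) * Complex.I_sq
  rw [fourier_expRight hε, fourier_expLeft hε]
  push_cast
  rw [h3]
  field_simp
  ring

/-- The difference retains the imaginary part. Applying -i sgn ξ on the frequency side thus turns
the Poisson kernel into its conjugate kernel. -/
theorem fourier_expRight_sub {ε : ℝ} (hε : 0 < ε) (x t : ℝ) :
    -Complex.I * (𝓕 (expRight ε x) t - 𝓕 (expLeft ε x) t)
      = (1 / Real.pi : ℂ) * (((x - t) / ((x - t) ^ 2 + ε ^ 2) : ℝ) : ℂ) := by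
  have hp : (Real.pi : ℂ) ≠ 0 := by simp [Real.pi_ne_zero]
  have h1 : (ε - ((x : ℂ) - t) * Complex.I) ≠ 0 :=
    fun h => hε.ne' (by simpa using congrArg Complex.re h)
  have h2 : (ε + ((x : ℂ) - t) * Complex.I) ≠ 0 :=
    fun h => hε.ne' (by simpa using congrArg Complex.re h)
  have h3 : ((x : ℂ) - t) ^ 2 + (ε : ℂ) ^ 2
      = (ε - ((x : ℂ) - t) * Complex.I) * (ε + ((x : ℂ) - t) * Complex.I) := by
    linear_combination (((x : ℂ) - t) ^ 2) * Complex.I_sq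
  have h4 : ((x : ℂ) - t) ^ 2 + (ε : ℂ) ^ 2 ≠ 0 := h3 ▸ mul_ne_zero h1 h2
  have key : ∀ A B : ℂ, A ≠ 0 → B ≠ 0 →
      1 / (2 * Real.pi * A) - 1 / (2 * Real.pi * B) = (B - A) / (2 * Real.pi * (A * B)) := by
    intro A B hA hB; field_simp
  rw [fourier_expRight hε, fourier_expLeft hε, key _ _ h1 h2, ← h3]
  push_cast
  field_simp
  linear_combination (-2 * ((x : ℂ) - t)) * Complex.I_sq

/-- The Fourier multiplier `-i sgn ξ` of the Hilbert transform. -/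
noncomputable def hilbertMultiplier (ξ : ℝ) : ℂ := if 0 < ξ then -Complex.I else Complex.I

theorem memLp_hilbertMultiplier : MemLp hilbertMultiplier ⊤ (volume : Measure ℝ) := by
  refine memLp_top_of_bound ?_ 1 (Eventually.of_forall fun ξ => ?_)
  · exact (Measurable.ite measurableSet_Ioi measurable_const measurable_const).aestronglyMeasurable
  · unfold hilbertMultiplier; split_ifs <;> simp

/-- The Hilbert transform on `L²(ℝ)`, as a Fourier multiplier. -/
noncomputable def hilbertCLM :
    Lp ℂ 2 (volume : Measure ℝ) →L[ℂ] Lp ℂ 2 (volume : Measure ℝ) :=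
  ((Lp.fourierTransformₗᵢ ℝ ℂ).symm : Lp ℂ 2 (volume : Measure ℝ) →L[ℂ] Lp ℂ 2 volume) ∘L
    (ContinuousLinearMap.mul ℂ ℂ).holderL volume ⊤ 2 2 (memLp_hilbertMultiplier.toLp _) ∘L
    ((Lp.fourierTransformₗᵢ ℝ ℂ) : Lp ℂ 2 (volume : Measure ℝ) →L[ℂ] Lp ℂ 2 volume)

theorem fourier_hilbertCLM (f : Lp ℂ 2 (volume : Measure ℝ)) :
    ∀ᵐ ξ, (𝓕 (hilbertCLM f) : Lp ℂ 2 (volume : Measure ℝ)) ξ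
      = hilbertMultiplier ξ * (𝓕 f : Lp ℂ 2 (volume : Measure ℝ)) ξ := by
  have h : (𝓕 (hilbertCLM f) : Lp ℂ 2 (volume : Measure ℝ)) =
      (ContinuousLinearMap.mul ℂ ℂ).holder 2 (memLp_hilbertMultiplier.toLp _) (𝓕 f) :=
    (Lp.fourierTransformₗᵢ ℝ ℂ).apply_symm_apply _
  rw [h]
  filter_upwards [(ContinuousLinearMap.mul ℂ ℂ).coeFn_holder (r := 2)
    (memLp_hilbertMultiplier.toLp _) (𝓕 f : Lp ℂ 2 (volume : Measure ℝ)),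
    memLp_hilbertMultiplier.coeFn_toLp] with ξ h1 h2
  rw [h1, h2]; rfl

/-- By the multiplication formula both sides become frequency integrals against the half-line
exponentials. On each half-line the multiplier is the constant -i or i, so it can be transferred
from f to the kernel. -/
theorem integral_hilbertCLM_mul_poisson (f : Lp ℂ 2 (volume : Measure ℝ)) {ε : ℝ} (hε : 0 < ε)
    (x : ℝ) :
    ∫ t, hilbertCLM f t * ((1 / Real.pi : ℂ) * ((ε / ((x - t) ^ 2 + ε ^ 2) : ℝ) : ℂ))
      = ∫ t, f t * ((1 / Real.pi : ℂ) * (((x - t) / ((x - t) ^ 2 + ε ^ 2) : ℝ) : ℂ)) := by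
  have hR := integrable_expRight hε x
  have hL := integrable_expLeft hε x
  have hR2 := memLp_expRight hε x
  have hL2 := memLp_expLeft hε x
  have hRK := memLp_fourier_expRight hε x
  have hLK := memLp_fourier_expLeft hε x
  simp_rw [← fourier_expRight_add hε, ← fourier_expRight_sub hε]
  have i1 : ∀ (h : Lp ℂ 2 (volume : Measure ℝ)) {m : ℝ → ℂ}, MemLp m 2 volume →
      Integrable fun t => h t * m t := fun h m hm => (Lp.memLp h).integrable_mul (q := 2) hm
  calc ∫ t, hilbertCLM f t * (𝓕 (expRight ε x) t + 𝓕 (expLeft ε x) t)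
      = ∫ ξ, (𝓕 (hilbertCLM f) : Lp ℂ 2 (volume : Measure ℝ)) ξ *
          (expRight ε x ξ + expLeft ε x ξ) := by
        simp_rw [mul_add]
        rw [integral_add (i1 _ hRK) (i1 _ hLK), integral_add (i1 _ hR2) (i1 _ hL2),
          integral_fourier_mul _ hR hR2 hRK, integral_fourier_mul _ hL hL2 hLK]
    _ = ∫ ξ, -Complex.I * ((𝓕 f : Lp ℂ 2 (volume : Measure ℝ)) ξ *
          expRight ε x ξ - (𝓕 f : Lp ℂ 2 (volume : Measure ℝ)) ξ * expLeft ε x ξ) := by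
        refine integral_congr_ae ?_
        filter_upwards [fourier_hilbertCLM f] with ξ hξ
        rw [hξ]
        by_cases h : 0 < ξ
        · have h' : ξ ∉ Set.Iic (0 : ℝ) := by simpa using h
          simp only [hilbertMultiplier, if_pos h, expLeft, Set.indicator_of_notMem h']
          ring
        · have h' : ξ ∉ Set.Ioi (0 : ℝ) := h
          simp only [hilbertMultiplier, if_neg h, expRight, Set.indicator_of_notMem h']
          ring
    _ = ∫ t, f t * (-Complex.I * (𝓕 (expRight ε x) t - 𝓕 (expLeft ε x) t)) := by
        rw [integral_const_mul, integral_sub (i1 _ hR2) (i1 _ hL2),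
          integral_fourier_mul _ hR hR2 hRK, integral_fourier_mul _ hL hL2 hLK,
          ← integral_sub (i1 _ hRK) (i1 _ hLK), ← integral_const_mul]
        refine integral_congr_ae (Eventually.of_forall fun t => ?_)
        simp only; ring

/-! ### Almost everywhere existence of principal values -/

theorem memLp_poisson {ε : ℝ} (hε : 0 < ε) (x : ℝ) :
    MemLp (fun t : ℝ => ε / ((x - t) ^ 2 + ε ^ 2)) 2 volume := by
  have hm : Measurable fun t : ℝ => ε / ((x - t) ^ 2 + ε ^ 2) := by fun_prop
  refine (memLp_two_iff_integrable_sq hm.aestronglyMeasurable).2 ?_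
  refine ((integrable_poisson hε x).const_mul ε⁻¹).mono' (hm.pow_const 2).aestronglyMeasurable
    (Eventually.of_forall fun t => ?_)
  have h0 : 0 ≤ ε / ((x - t) ^ 2 + ε ^ 2) := by positivity
  have h1 : ε / ((x - t) ^ 2 + ε ^ 2) ≤ ε⁻¹ := by
    rw [inv_eq_one_div, div_le_div_iff₀ (by positivity) hε]; nlinarith [sq_nonneg (x - t)]
  rw [Real.norm_of_nonneg (by positivity), sq]
  gcongr

/-- A family of kernels dominated by the Poisson kernel does not see the oscillation of `f` at a
Lebesgue point. -/
theorem tendsto_integral_mul_kernel {f : ℝ → ℂ} (hf : MemLp f 2 volume) {x : ℝ}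
    (hx : Tendsto (fun r => ⨍ y in Metric.closedBall x r, ‖f y - f x‖) (𝓝[>] 0) (𝓝 0))
    {k : ℝ → ℝ → ℂ} (hkm : ∀ ε, Measurable (k ε))
    (hk : ∀ ε, 0 < ε → ∀ s, ‖k ε s‖ ≤ ε / (s ^ 2 + ε ^ 2))
    {c : ℂ} (hc : ∀ ε, 0 < ε → ∫ t, k ε (x - t) = c) :
    Tendsto (fun ε => ∫ t, f t * k ε (x - t)) (𝓝[>] 0) (𝓝 (f x * c)) := by
  rw [tendsto_iff_norm_sub_tendsto_zero]
  refine squeeze_zero' (Eventually.of_forall fun _ => norm_nonneg _) ?_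
    (tendsto_integral_poisson_norm_sub hf hx)
  filter_upwards [self_mem_nhdsWithin] with ε hε
  have hε : (0 : ℝ) < ε := hε
  have hkm' : Measurable fun t => k ε (x - t) := (hkm ε).comp (measurable_const.sub measurable_id)
  have hki : Integrable fun t => k ε (x - t) :=
    (integrable_poisson hε x).mono' hkm'.aestronglyMeasurable (Eventually.of_forall fun t => hk ε hε _)
  have hk2 : MemLp (fun t => k ε (x - t)) 2 volume :=
    (memLp_poisson hε x).of_le hkm'.aestronglyMeasurable (Eventually.of_forall fun t =>
      (hk ε hε _).trans (Real.le_norm_self _))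
  have hfk : Integrable fun t => f t * k ε (x - t) := hf.integrable_mul (q := 2) hk2
  have hfp : Integrable fun t => ε / ((x - t) ^ 2 + ε ^ 2) * ‖f t - f x‖ := by
    have h1 : Integrable fun t => ε / ((x - t) ^ 2 + ε ^ 2) * ‖f t‖ :=
      (memLp_poisson hε x).integrable_mul (q := 2) hf.norm
    refine (h1.add ((integrable_poisson hε x).mul_const ‖f x‖)).mono' ?_
      (Eventually.of_forall fun t => ?_)
    · exact (integrable_poisson hε x).1.mul (hf.1.sub aestronglyMeasurable_const).norm
    · have : 0 ≤ ε / ((x - t) ^ 2 + ε ^ 2) := by positivity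
      rw [Real.norm_of_nonneg (by positivity), Pi.add_apply, ← mul_add]
      gcongr
      exact norm_sub_le _ _
  -- Because the kernel has integral `c`, the limit value enters the integral and only f(t) - f(x)
  -- remains against the kernel.
  rw [← hc ε hε, ← integral_const_mul, ← integral_sub hfk (hki.const_mul _)]
  refine norm_integral_le_of_norm_le hfp (Eventually.of_forall fun t => ?_)
  rw [← sub_mul, norm_mul, mul_comm]
  gcongr
  exact hk ε hε _

/-- The difference between the conjugate Poisson kernel and the truncated Hilbert kernel. -/
noncomputable def kernelDefect (ε s : ℝ) : ℂ :=
  ((s / (s ^ 2 + ε ^ 2) - if ε ≤ |s| then 1 / s else 0 : ℝ) : ℂ)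

theorem measurable_kernelDefect (ε : ℝ) : Measurable (kernelDefect ε) := by
  refine Complex.measurable_ofReal.comp (Measurable.sub (by fun_prop) ?_)
  exact Measurable.ite (measurableSet_le measurable_const (by fun_prop)) (by fun_prop)
    measurable_const

/-- For |s| ≥ ε the two kernels nearly cancel, leaving -ε² / (s (s² + ε²)), and one factor ε is
absorbed by |s|. For |s| < ε only s / (s² + ε²) is present. -/
theorem norm_kernelDefect_le {ε : ℝ} (hε : 0 < ε) (s : ℝ) :
    ‖kernelDefect ε s‖ ≤ ε / (s ^ 2 + ε ^ 2) := by
  rw [kernelDefect, Complex.norm_real, Real.norm_eq_abs]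
  split_ifs with h
  · have hs : s ≠ 0 := fun h0 => by rw [h0, abs_zero] at h; linarith
    have hs' : 0 < |s| := abs_pos.2 hs
    have e : s / (s ^ 2 + ε ^ 2) - 1 / s = -(ε ^ 2 / (s * (s ^ 2 + ε ^ 2))) := by
      field_simp; ring
    rw [e, abs_neg, abs_div, abs_mul, abs_of_pos (show 0 < s ^ 2 + ε ^ 2 by positivity),
      abs_of_pos (show 0 < ε ^ 2 by positivity), div_le_div_iff₀ (by positivity) (by positivity)]
    have : 0 < s ^ 2 + ε ^ 2 := by positivity
    nlinarith [mul_le_mul_of_nonneg_right h (mul_pos hε this).le]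
  · rw [sub_zero, abs_div, abs_of_pos (show 0 < s ^ 2 + ε ^ 2 by positivity)]
    gcongr
    exact (not_le.1 h).le

theorem integral_kernelDefect (ε x : ℝ) : ∫ t, kernelDefect ε (x - t) = 0 := by
  rw [integral_sub_left_eq_self (kernelDefect ε) volume x]
  have h : ∀ s, kernelDefect ε (-s) = -kernelDefect ε s := by
    intro s
    simp only [kernelDefect, abs_neg]
    split_ifs <;> push_cast <;> ring
  have h2 := integral_neg_eq_self (kernelDefect ε) volume
  simp_rw [h] at h2
  rw [integral_neg] at h2
  exact self_eq_neg.1 h2.symm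

/-- Away from the singularity (x - t)⁻² ≤ 2 / ((x - t)² + ε²), so the truncated kernel is in L² and
Cauchy-Schwarz applies. -/
theorem integrable_truncated {f : ℝ → ℂ} (hf : MemLp f 2 volume) (x : ℝ) {ε : ℝ} (hε : 0 < ε) :
    IntegrableOn (fun t => f t / ((x : ℂ) - (t : ℂ))) {t : ℝ | ε ≤ |x - t|} := by
  have hs : MeasurableSet {t : ℝ | ε ≤ |x - t|} :=
    measurableSet_le measurable_const (by fun_prop)
  have hm : Measurable fun t : ℝ => (1 : ℂ) / ((x : ℂ) - (t : ℂ)) := by fun_prop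
  have hk : MemLp (fun t : ℝ => (1 : ℂ) / ((x : ℂ) - (t : ℂ))) 2
      (volume.restrict {t : ℝ | ε ≤ |x - t|}) := by
    have h2 : MemLp (fun t : ℝ => ‖(1 : ℂ) / ((x : ℂ) - (t : ℂ))‖ ^ 2) 1
        (volume.restrict {t : ℝ | ε ≤ |x - t|}) := by
      refine memLp_one_iff_integrable.2 ?_
      refine (((integrable_poisson hε x).const_mul (2 / ε)).integrableOn).mono'
        (hm.norm.pow_const 2).aestronglyMeasurable ?_
      filter_upwards [ae_restrict_mem hs] with t ht
      have ht : ε ≤ |x - t| := ht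
      have h3 : ε ^ 2 ≤ (x - t) ^ 2 := by rw [← sq_abs (x - t)]; gcongr
      have h4 : 0 < (x - t) ^ 2 := lt_of_lt_of_le (by positivity) h3
      have h5 : ‖(1 : ℂ) / ((x : ℂ) - (t : ℂ))‖ ^ 2 = 1 / (x - t) ^ 2 := by
        rw [← Complex.ofReal_sub, norm_div, Complex.norm_real, norm_one, div_pow, Real.norm_eq_abs,
          sq_abs, one_pow]
      rw [h5, Real.norm_of_nonneg (by positivity)]
      have : 2 / ε * (ε / ((x - t) ^ 2 + ε ^ 2)) = 2 / ((x - t) ^ 2 + ε ^ 2) := by field_simp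
      rw [this, div_le_div_iff₀ h4 (by positivity)]
      linarith
    exact (memLp_two_iff_integrable_sq_norm hm.aestronglyMeasurable).2 (memLp_one_iff_integrable.1 h2)
  have := (hf.restrict {t : ℝ | ε ≤ |x - t|}).integrable_mul (q := 2) hk
  refine this.congr (Eventually.of_forall fun t => ?_)
  simp only [Pi.mul_apply]; ring

/-- The truncated kernel is the conjugate Poisson kernel minus the defect, and the conjugate Poisson
integral of `f` has been rewritten as the Poisson integral of `hilbertCLM f`. Both remaining kernels
are dominated by the Poisson kernel. -/
theorem truncatedHilbert_eq (f : Lp ℂ 2 (volume : Measure ℝ)) {ε : ℝ} (hε : 0 < ε) (x : ℝ) :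
    truncatedHilbert f x ε
      = (1 / Real.pi : ℂ) * (∫ t, hilbertCLM f t * ((ε / ((x - t) ^ 2 + ε ^ 2) : ℝ) : ℂ))
        - (1 / Real.pi : ℂ) * ∫ t, f t * kernelDefect ε (x - t) := by
  have h1 := integral_hilbertCLM_mul_poisson f hε x
  simp_rw [mul_left_comm _ (1 / Real.pi : ℂ)] at h1
  rw [integral_const_mul, integral_const_mul] at h1
  have hs : MeasurableSet {t : ℝ | ε ≤ |x - t|} :=
    measurableSet_le measurable_const (by fun_prop)
  have hti := (integrable_indicator_iff hs).2 (integrable_truncated (Lp.memLp f) x hε)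
  have hki : Integrable fun t => f t * kernelDefect ε (x - t) := by
    refine (Lp.memLp f).integrable_mul (q := 2) ((memLp_poisson hε x).of_le
      ((measurable_kernelDefect ε).comp (measurable_const.sub measurable_id)).aestronglyMeasurable
      (Eventually.of_forall fun t => (norm_kernelDefect_le hε _).trans (Real.le_norm_self _)))
  rw [h1, ← mul_sub, truncatedHilbert, ← integral_indicator hs]
  congr 1
  rw [eq_sub_iff_add_eq, ← integral_add hti hki]
  refine integral_congr_ae (Eventually.of_forall fun t => ?_)
  simp only [kernelDefect]
  by_cases h : ε ≤ |x - t|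
  · rw [Set.indicator_of_mem (show t ∈ {t : ℝ | ε ≤ |x - t|} from h), if_pos h]
    push_cast; ring
  · rw [Set.indicator_of_notMem (show t ∉ {t : ℝ | ε ≤ |x - t|} from h), if_neg h]
    push_cast; ring

theorem ae_lebesguePoint {f : ℝ → ℂ} (hf : MemLp f 2 volume) : ∀ᵐ x : ℝ,
    Tendsto (fun r => ⨍ y in Metric.closedBall x r, ‖f y - f x‖) (𝓝[>] 0) (𝓝 0) := by
  filter_upwards [IsUnifLocDoublingMeasure.ae_tendsto_average_norm_sub volume
    (hf.locallyIntegrable (by norm_num)) 1] with x hx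
  refine hx (fun _ => x) id tendsto_id ?_
  filter_upwards [self_mem_nhdsWithin] with r hr
  have : (0 : ℝ) < r := hr
  simpa using this.le

/-- The principal value defining the Hilbert transform of `f ∈ L²(ℝ)` exists almost everywhere and
agrees with the Fourier multiplier. -/
theorem tendsto_truncatedHilbert (f : Lp ℂ 2 (volume : Measure ℝ)) :
    ∀ᵐ x : ℝ, Tendsto (truncatedHilbert f x) (𝓝[>] 0) (𝓝 (hilbertCLM f x)) := by
  filter_upwards [ae_lebesguePoint (Lp.memLp f), ae_lebesguePoint (Lp.memLp (hilbertCLM f))]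
    with x h1 h2
  have t1 := tendsto_integral_mul_kernel (Lp.memLp f) h1 measurable_kernelDefect
    (fun ε hε s => norm_kernelDefect_le hε s) (fun ε _ => integral_kernelDefect ε x)
  have t2 := tendsto_integral_mul_kernel (Lp.memLp (hilbertCLM f)) h2
    (k := fun ε s => ((ε / (s ^ 2 + ε ^ 2) : ℝ) : ℂ)) (c := Real.pi) (fun ε => by fun_prop)
    (fun ε hε s => by rw [Complex.norm_real, Real.norm_of_nonneg (by positivity)])
    (fun ε hε => by rw [integral_complex_ofReal, integral_poisson hε])
  have t3 := (t2.const_mul (1 / Real.pi : ℂ)).sub (t1.const_mul (1 / Real.pi : ℂ))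
  have e : (1 / Real.pi : ℂ) * (hilbertCLM f x * Real.pi) - (1 / Real.pi : ℂ) * (f x * 0)
      = hilbertCLM f x := by
    have : (Real.pi : ℂ) ≠ 0 := by simp [Real.pi_ne_zero]
    field_simp; ring
  rw [e] at t3
  refine t3.congr' ?_
  filter_upwards [self_mem_nhdsWithin] with ε hε
  exact (truncatedHilbert_eq f hε x).symm

/-! ### Primitives, integration by parts and weak derivatives on the line -/

theorem intervalIntegrable_of_locallyIntegrable {F : ℝ → ℂ} (hF : LocallyIntegrable F) (a b : ℝ) :
    IntervalIntegrable F volume a b :=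
  intervalIntegrable_iff.mpr
    ((hF.integrableOn_isCompact isCompact_uIcc).mono_set Set.uIoc_subset_uIcc)

/-- Fubini on the triangle t ≤ x inside (a, b]². This avoids differentiating the primitive of a
merely locally integrable function. -/
theorem integral_primitive_mul_deriv_of_le {F φ : ℝ → ℂ} (hF : LocallyIntegrable F)
    (hφ : ContDiff ℝ 1 φ) {a b : ℝ} (hab : a ≤ b) :
    ∫ x in a..b, (∫ t in a..x, F t) * deriv φ x
      = (∫ t in a..b, F t) * φ b - ∫ t in a..b, F t * φ t := by
  have hd : Continuous (deriv φ) := hφ.continuous_deriv le_rfl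
  set μ : Measure ℝ := volume.restrict (Set.Ioc a b)
  have hFi : IntegrableOn F (Set.Ioc a b) :=
    (hF.integrableOn_isCompact isCompact_Icc).mono_set Set.Ioc_subset_Icc_self
  have hdi : IntegrableOn (deriv φ) (Set.Ioc a b) :=
    (hd.continuousOn.integrableOn_compact isCompact_Icc).mono_set Set.Ioc_subset_Icc_self
  have hprod : Integrable (Function.uncurry fun x t : ℝ =>
      {p : ℝ × ℝ | p.2 ≤ p.1}.indicator (fun p => deriv φ p.1 * F p.2) (x, t)) (μ.prod μ) := by
    refine Integrable.indicator (Integrable.mul_prod hdi hFi) ?_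
    exact measurableSet_le measurable_snd measurable_fst
  have hswap := integral_integral_swap hprod
  rw [intervalIntegral.integral_of_le hab, intervalIntegral.integral_of_le hab,
    intervalIntegral.integral_of_le hab]
  have e1 : ∫ x in Set.Ioc a b, (∫ t in a..x, F t) * deriv φ x = ∫ x, ∫ t,
      {p : ℝ × ℝ | p.2 ≤ p.1}.indicator (fun p => deriv φ p.1 * F p.2) (x, t) ∂μ ∂μ := by
    refine setIntegral_congr_fun measurableSet_Ioc fun x hx => ?_
    have : ∀ t, {p : ℝ × ℝ | p.2 ≤ p.1}.indicator (fun p => deriv φ p.1 * F p.2) (x, t)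
        = deriv φ x * (Set.Iic x).indicator F t := by
      intro t
      by_cases h : t ≤ x
      · rw [Set.indicator_of_mem (show (x, t) ∈ {p : ℝ × ℝ | p.2 ≤ p.1} from h),
          Set.indicator_of_mem (show t ∈ Set.Iic x from h)]
      · rw [Set.indicator_of_notMem (show (x, t) ∉ {p : ℝ × ℝ | p.2 ≤ p.1} from h),
          Set.indicator_of_notMem (show t ∉ Set.Iic x from h), mul_zero]
    simp_rw [this]
    rw [integral_const_mul, integral_indicator measurableSet_Iic,
      Measure.restrict_restrict measurableSet_Iic, mul_comm, intervalIntegral.integral_of_le hx.1.le]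
    congr 3
    ext t
    simp only [Set.mem_Ioc, Set.mem_inter_iff, Set.mem_Iic]
    exact ⟨fun h => ⟨h.2, h.1, h.2.trans hx.2⟩, fun h => ⟨h.2.1, h.1⟩⟩
  have e2 : ∫ t, ∫ x, {p : ℝ × ℝ | p.2 ≤ p.1}.indicator (fun p => deriv φ p.1 * F p.2) (x, t) ∂μ ∂μ
      = ∫ t in Set.Ioc a b, (F t * φ b - F t * φ t) := by
    refine setIntegral_congr_fun measurableSet_Ioc fun t ht => ?_
    have : ∀ x, {p : ℝ × ℝ | p.2 ≤ p.1}.indicator (fun p => deriv φ p.1 * F p.2) (x, t)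
        = (Set.Ici t).indicator (deriv φ) x * F t := by
      intro x
      by_cases h : t ≤ x
      · rw [Set.indicator_of_mem (show (x, t) ∈ {p : ℝ × ℝ | p.2 ≤ p.1} from h),
          Set.indicator_of_mem (show x ∈ Set.Ici t from h)]
      · rw [Set.indicator_of_notMem (show (x, t) ∉ {p : ℝ × ℝ | p.2 ≤ p.1} from h),
          Set.indicator_of_notMem (show x ∉ Set.Ici t from h), zero_mul]
    simp_rw [this]
    have hset : Set.Ici t ∩ Set.Ioc a b = Set.Icc t b := by
      ext x
      simp only [Set.mem_Ioc, Set.mem_inter_iff, Set.mem_Icc, Set.mem_Ici]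
      exact ⟨fun h => ⟨h.1, h.2.2⟩, fun h => ⟨h.1, ht.1.trans_le h.1, h.2⟩⟩
    rw [integral_mul_const, integral_indicator measurableSet_Ici,
      Measure.restrict_restrict measurableSet_Ici, hset, integral_Icc_eq_integral_Ioc,
      ← intervalIntegral.integral_of_le ht.2, intervalIntegral.integral_deriv_eq_sub
        (fun x _ => (hφ.differentiable one_ne_zero).differentiableAt) (hd.intervalIntegrable _ _)]
    ring
  have i2 : IntegrableOn (fun t => F t * φ t) (Set.Ioc a b) := by
    have h := hF.integrableOn_isCompact (isCompact_Icc (a := a) (b := b))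
    exact (h.mul_continuousOn hφ.continuous.continuousOn isCompact_Icc).mono_set
      Set.Ioc_subset_Icc_self
  rw [e1, hswap, e2, integral_sub (hFi.mul_const _) i2, integral_mul_const]

/-- Integration by parts for an indefinite integral against a `C¹` function. -/
theorem integral_primitive_mul_deriv {F φ : ℝ → ℂ} (hF : LocallyIntegrable F)
    (hφ : ContDiff ℝ 1 φ) (a b c : ℝ) :
    ∫ x in a..b, (∫ t in c..x, F t) * deriv φ x
      = (∫ t in c..b, F t) * φ b - (∫ t in c..a, F t) * φ a - ∫ t in a..b, F t * φ t := by
  wlog hab : a ≤ b generalizing a b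
  · have h := this b a (le_of_not_ge hab)
    rw [intervalIntegral.integral_symm b a, h, intervalIntegral.integral_symm b a]
    ring
  have hd : Continuous (deriv φ) := hφ.continuous_deriv le_rfl
  have hfi : ∀ c d, IntervalIntegrable F volume c d := intervalIntegrable_of_locallyIntegrable hF
  have hW : Continuous fun x => ∫ t in a..x, F t := intervalIntegral.continuous_primitive hfi a
  have hWd : Continuous fun x => (∫ t in a..x, F t) * deriv φ x := hW.mul hd
  have e : ∀ x, (∫ t in c..x, F t) * deriv φ x
      = (∫ t in c..a, F t) * deriv φ x + (∫ t in a..x, F t) * deriv φ x := by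
    intro x
    rw [← intervalIntegral.integral_add_adjacent_intervals (hfi c a) (hfi a x), add_mul]
  simp_rw [e]
  rw [intervalIntegral.integral_add ((hd.intervalIntegrable _ _).const_mul _)
    (hWd.intervalIntegrable _ _), intervalIntegral.integral_const_mul,
    intervalIntegral.integral_deriv_eq_sub
      (fun x _ => (hφ.differentiable one_ne_zero).differentiableAt) (hd.intervalIntegrable _ _),
    integral_primitive_mul_deriv_of_le hF hφ hab,
    ← intervalIntegral.integral_add_adjacent_intervals (hfi c a) (hfi a b)]
  ring

theorem exists_support_Ioc {φ : ℝ → ℂ} (hc : HasCompactSupport φ) :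
    ∃ R : ℝ, 0 < R ∧ ∀ x, R ≤ |x| → φ x = 0 ∧ deriv φ x = 0 := by
  obtain ⟨R, hR⟩ := hc.isBounded.subset_closedBall 0
  refine ⟨max R 0 + 1, by positivity, fun x hx => ?_⟩
  have hx' : x ∉ tsupport φ := fun h => by
    have := hR h
    rw [mem_closedBall_zero_iff, Real.norm_eq_abs] at this
    linarith [le_max_left R 0]
  exact ⟨image_eq_zero_of_notMem_tsupport hx',
    Function.notMem_support.1 fun h => hx' (support_deriv_subset h)⟩

theorem integral_eq_intervalIntegral_of_eq_zero {h : ℝ → ℂ} {R : ℝ} (hR : 0 < R)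
    (h0 : ∀ x, R ≤ |x| → h x = 0) : ∫ x, h x = ∫ x in (-R)..R, h x := by
  rw [intervalIntegral.integral_of_le (by linarith)]
  refine (setIntegral_eq_integral_of_forall_compl_eq_zero fun x hx => h0 x ?_).symm
  by_contra hlt
  have := abs_lt.1 (not_le.1 hlt)
  exact hx ⟨this.1, this.2.le⟩

/-- The boundary terms vanish with φ. This is how an indefinite integral is recognised as having
weak derivative `F`. -/
theorem integral_const_add_primitive_mul_deriv {F φ : ℝ → ℂ} (hF : LocallyIntegrable F)
    (hφ : ContDiff ℝ 1 φ) (hc : HasCompactSupport φ) (k : ℂ) (c : ℝ) :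
    ∫ x, (k + ∫ t in c..x, F t) * deriv φ x = -∫ x, F x * φ x := by
  obtain ⟨R, hR, h0⟩ := exists_support_Ioc hc
  have hd : Continuous (deriv φ) := hφ.continuous_deriv le_rfl
  have hfi : ∀ c d, IntervalIntegrable F volume c d := intervalIntegrable_of_locallyIntegrable hF
  have hW : Continuous fun x => ∫ t in c..x, F t := intervalIntegral.continuous_primitive hfi c
  have hWd : Continuous fun x => (∫ t in c..x, F t) * deriv φ x := hW.mul hd
  have hp := (h0 R (le_abs_self R)).1
  have hn := (h0 (-R) (by rw [abs_neg]; exact le_abs_self R)).1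
  rw [integral_eq_intervalIntegral_of_eq_zero hR fun x hx => by rw [(h0 x hx).2, mul_zero],
    integral_eq_intervalIntegral_of_eq_zero hR fun x hx => by rw [(h0 x hx).1, mul_zero]]
  simp_rw [add_mul]
  rw [intervalIntegral.integral_add ((hd.intervalIntegrable _ _).const_mul _)
    (hWd.intervalIntegrable _ _), integral_primitive_mul_deriv hF hφ,
    intervalIntegral.integral_const_mul, intervalIntegral.integral_deriv_eq_sub
      (fun x _ => (hφ.differentiable one_ne_zero).differentiableAt) (hd.intervalIntegrable _ _),
    hp, hn]
  ring

/-- A test function on an interval with vanishing integral is the derivative of a test function. -/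
theorem exists_primitive_test {U : Set ℝ} (hU : U.OrdConnected) {θ : ℝ → ℂ}
    (hθ : ContDiff ℝ ∞ θ) (hc : HasCompactSupport θ) (hs : tsupport θ ⊆ U) (h0 : ∫ x, θ x = 0) :
    ∃ Θ : ℝ → ℂ, ContDiff ℝ ∞ Θ ∧ HasCompactSupport Θ ∧ tsupport Θ ⊆ U ∧ deriv Θ = θ := by
  rcases (tsupport θ).eq_empty_or_nonempty with he | hne
  · have : θ = 0 := tsupport_eq_empty_iff.1 he
    refine ⟨0, contDiff_const, HasCompactSupport.zero, by simp, ?_⟩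
    rw [this]; funext x; simp
  obtain ⟨a, ha, hal⟩ := hc.isCompact.exists_isLeast hne
  obtain ⟨b, hb, hbg⟩ := hc.isCompact.exists_isGreatest hne
  have hz : ∀ x, x ∉ Set.Icc a b → θ x = 0 := fun x hx =>
    image_eq_zero_of_notMem_tsupport fun h => hx ⟨hal h, hbg h⟩
  have hab : a ≤ b := hal hb
  have hder : ∀ x, HasDerivAt (fun x => ∫ t in a..x, θ t) (θ x) x := fun x =>
    intervalIntegral.integral_hasDerivAt_right (hθ.continuous.intervalIntegrable _ _)
      (hθ.continuous.stronglyMeasurableAtFilter _ _) hθ.continuous.continuousAt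
  have hd : deriv (fun x => ∫ t in a..x, θ t) = θ := funext fun x => (hder x).deriv
  have hsupp : ∀ x, x ∉ Set.Icc a b → ∫ t in a..x, θ t = 0 := by
    intro x hx
    rcases lt_or_ge x a with h | h
    · rw [intervalIntegral.integral_symm, intervalIntegral.integral_of_le h.le,
        integral_Ioc_eq_integral_Ioo, setIntegral_eq_zero_of_forall_eq_zero, neg_zero]
      exact fun t ht => hz t fun h' => absurd h'.1 (not_le.2 ht.2)
    · have hbx : b < x := by
        by_contra hcon; exact hx ⟨h, not_lt.1 hcon⟩
      -- To the right of the support the primitive has collected the whole integral, which is zero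
      -- by `h0`.
      rw [intervalIntegral.integral_of_le h, ← integral_Icc_eq_integral_Ioc,
        setIntegral_eq_integral_of_forall_compl_eq_zero, h0]
      exact fun t ht => hz t fun h' => ht ⟨h'.1, h'.2.trans hbx.le⟩
  have hts : tsupport (fun x => ∫ t in a..x, θ t) ⊆ Set.Icc a b := by
    refine closure_minimal (fun x hx => ?_) isClosed_Icc
    by_contra hcon
    exact hx (hsupp x hcon)
  refine ⟨fun x => ∫ t in a..x, θ t, ?_, ?_, hts.trans (hU.out (hs ha) (hs hb)), hd⟩
  · refine contDiff_infty_iff_deriv.2 ⟨fun x => (hder x).differentiableAt, ?_⟩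
    rw [hd]; exact hθ
  · exact HasCompactSupport.of_support_subset_isCompact isCompact_Icc
      ((subset_tsupport _).trans hts)

/-- Du Bois-Reymond: a function on an open interval whose weak derivative vanishes is constant. -/
theorem exists_ae_eq_const {U : Set ℝ} (hU : IsOpen U) (hUc : U.OrdConnected) (hne : U.Nonempty)
    {f : ℝ → ℂ} (hf : LocallyIntegrable f)
    (h : ∀ φ : ℝ → ℂ, ContDiff ℝ ∞ φ → HasCompactSupport φ → tsupport φ ⊆ U →
      ∫ x, f x * deriv φ x = 0) :
    ∃ c : ℂ, ∀ᵐ x, x ∈ U → f x = c := by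
  obtain ⟨x₀, hx₀⟩ := hne
  obtain ⟨ρ, hρ, hρU⟩ := Metric.isOpen_iff.1 hU x₀ hx₀
  -- A bump of unit mass supported in `U`: subtracting (∫ g) ψ from a test function g gives mean
  -- zero, hence a derivative of a test function. The constant sought is therefore ∫ f ψ.
  let β : ContDiffBump x₀ := ⟨ρ / 4, ρ / 2, by positivity, by linarith⟩
  set ψ : ℝ → ℝ := β.normed volume
  have hψ1 : ∫ x, ψ x = 1 := β.integral_normed
  have hψd : ContDiff ℝ ∞ ψ := β.contDiff_normed
  have hψc : HasCompactSupport ψ := β.hasCompactSupport_normed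
  have hψs : tsupport ψ ⊆ U := by
    rw [β.tsupport_normed_eq]
    exact (Metric.closedBall_subset_ball (by simp only [β]; linarith)).trans hρU
  have hmulint : ∀ g : ℝ → ℝ, Continuous g → HasCompactSupport g →
      Integrable fun x => f x * (g x : ℂ) := by
    intro g hg hgc
    have := hf.integrable_smul_left_of_hasCompactSupport hg hgc
    refine this.congr (Eventually.of_forall fun x => ?_)
    simp only [Complex.real_smul]; ring
  set c : ℂ := ∫ x, f x * (ψ x : ℂ)
  refine ⟨c, ?_⟩
  have hfc : LocallyIntegrable fun x => f x - c := hf.sub (locallyIntegrable_const c)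
  have key := hU.ae_eq_zero_of_integral_contDiff_smul_eq_zero (f := fun x => f x - c)
    (hfc.locallyIntegrableOn U) ?_
  · filter_upwards [key] with x hx hxU
    exact sub_eq_zero.1 (hx hxU)
  intro g hg hgc hgs
  set m : ℝ := ∫ x, g x
  have hgi : Integrable g := hg.continuous.integrable_of_hasCompactSupport hgc
  have hψi : Integrable ψ := hψd.continuous.integrable_of_hasCompactSupport hψc
  have hθs : tsupport (fun x => ((g x - m * ψ x : ℝ) : ℂ)) ⊆ tsupport g ∪ tsupport ψ := by
    refine closure_minimal (fun x hx => ?_) ((isClosed_tsupport g).union (isClosed_tsupport ψ))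
    by_contra hcon
    rw [Set.mem_union, not_or] at hcon
    apply hx
    simp only
    rw [image_eq_zero_of_notMem_tsupport hcon.1, image_eq_zero_of_notMem_tsupport hcon.2]
    simp
  obtain ⟨Θ, hΘ, hΘc, hΘs, hΘd⟩ := exists_primitive_test hUc
    (θ := fun x => ((g x - m * ψ x : ℝ) : ℂ))
    (Complex.ofRealCLM.contDiff.comp (hg.sub (contDiff_const.mul hψd)))
    (HasCompactSupport.of_support_subset_isCompact (hgc.isCompact.union hψc.isCompact)
      ((subset_tsupport _).trans hθs))
    (hθs.trans (Set.union_subset hgs hψs))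
    (by
      rw [integral_complex_ofReal, integral_sub hgi (hψi.const_mul m), integral_const_mul, hψ1,
        mul_one, sub_self, Complex.ofReal_zero])
  have h1 := h Θ hΘ hΘc hΘs
  rw [hΘd] at h1
  have e1 : ∀ x, f x * ((g x - m * ψ x : ℝ) : ℂ) = f x * (g x : ℂ) - m * (f x * (ψ x : ℂ)) := by
    intro x; push_cast; ring
  simp_rw [e1] at h1
  rw [integral_sub (hmulint g hg.continuous hgc) ((hmulint ψ hψd.continuous hψc).const_mul _),
    integral_const_mul] at h1
  have e2 : ∀ x, g x • (f x - c) = f x * (g x : ℂ) - (g x : ℂ) * c := by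
    intro x; rw [Complex.real_smul]; ring
  simp_rw [e2]
  have hgC : Integrable fun x => (g x : ℂ) := hgi.ofReal
  rw [integral_sub (hmulint g hg.continuous hgc) (hgC.mul_const c), integral_mul_const,
    integral_complex_ofReal]
  exact h1

/-! ### Continuous representatives and traces on ℰ -/

theorem isOpen_freeSurface : IsOpen freeSurface := isOpen_lt continuous_const continuous_abs

theorem measurableSet_freeSurface : MeasurableSet freeSurface := isOpen_freeSurface.measurableSet

theorem Ioi_one_subset_freeSurface : Set.Ioi 1 ⊆ freeSurface := fun x hx =>
  lt_of_lt_of_le (show 1 < x from hx) (le_abs_self x)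

theorem Iio_neg_one_subset_freeSurface : Set.Iio (-1) ⊆ freeSurface := fun x hx =>
  lt_of_lt_of_le (by have : x < -1 := hx; linarith) (neg_le_abs x)

theorem memLp_indicator_L2 {U : Set ℝ} (hU : MeasurableSet U) (v : L2 U) :
    MemLp (U.indicator v) 2 volume :=
  (memLp_indicator_iff_restrict hU).2 (Lp.memLp v)

theorem memLp_gExt (v : W12 freeSurface) : MemLp (gExt v) 2 volume :=
  memLp_indicator_L2 measurableSet_freeSurface _

theorem integral_indicator_mul {U : Set ℝ} (hU : MeasurableSet U) (v φ : ℝ → ℂ) :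
    ∫ x, U.indicator v x * φ x = ∫ x in U, v x * φ x := by
  rw [← integral_indicator hU]
  refine integral_congr_ae (Eventually.of_forall fun x => ?_)
  simp only [Set.indicator_mul_left]

/-- On an interval contained in `U`, an element of `W^{1,2}(U)` is an indefinite integral of its weak
derivative, up to a constant. -/
theorem exists_ae_eq_const_add_primitive {U I : Set ℝ} (hU : MeasurableSet U) (hI : IsOpen I)
    (hIc : I.OrdConnected) (hne : I.Nonempty) (hIU : I ⊆ U) (v : W12 U) (a : ℝ) :
    ∃ c : ℂ, ∀ᵐ x, x ∈ I → valFn v x = c + ∫ t in a..x, U.indicator (weakDeriv v) t := by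
  set F : ℝ → ℂ := U.indicator (weakDeriv v)
  have hv := (memLp_indicator_L2 hU (valFn v)).locallyIntegrable (by norm_num)
  have hF := (memLp_indicator_L2 hU (weakDeriv v)).locallyIntegrable (by norm_num)
  have hW : Continuous fun x => ∫ t in a..x, F t :=
    intervalIntegral.continuous_primitive (intervalIntegrable_of_locallyIntegrable hF) a
  obtain ⟨c, hc⟩ := exists_ae_eq_const hI hIc hne
    (f := fun x => U.indicator (valFn v) x - ∫ t in a..x, F t) (hv.sub hW.locallyIntegrable) (by
      intro φ hφ hφc hφs
      have hd : Continuous (deriv φ) := hφ.continuous_deriv (by simp)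
      have h1 := v.2 φ hφ hφc (hφs.trans hIU)
      have h2 := integral_const_add_primitive_mul_deriv hF (hφ.of_le (by simp)) hφc 0 a
      simp only [zero_add] at h2
      simp_rw [sub_mul]
      rw [integral_sub, h2, integral_indicator_mul hU, integral_indicator_mul hU]
      · have h1' : ∫ x in U, valFn v x * deriv φ x = -∫ x in U, weakDeriv v x * φ x := h1
        rw [h1', sub_self]
      · exact (memLp_indicator_L2 hU (valFn v)).integrable_mul (q := 2)
          (hd.memLp_of_hasCompactSupport hφc.deriv)
      · exact (hW.mul hd).integrable_of_hasCompactSupport (hφc.deriv.mul_left))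
  refine ⟨c, ?_⟩
  filter_upwards [hc] with x hx hxI
  rw [← hx hxI, Set.indicator_of_mem (hIU hxI)]
  ring

/-- `w` is the representative of `v` that is continuous up to `±1`. -/
structure IsContRep (v : W12 freeSurface) (w : ℝ → ℂ) : Prop where
  ae_eq : ∀ᵐ x ∂(volume.restrict freeSurface), valFn v x = w x
  right : ∀ x, 1 ≤ x → w x = w 1 + ∫ t in (1 : ℝ)..x, gExt v t
  left : ∀ x, x ≤ -1 → w x = w (-1) + ∫ t in (-1 : ℝ)..x, gExt v t

theorem locallyIntegrable_gExt (v : W12 freeSurface) : LocallyIntegrable (gExt v) :=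
  (memLp_gExt v).locallyIntegrable (by norm_num)

theorem IsContRep.continuousOn {v : W12 freeSurface} {w : ℝ → ℂ} (h : IsContRep v w) :
    ContinuousOn w {x : ℝ | 1 ≤ |x|} := by
  have hc : ∀ a, Continuous fun x => ∫ t in a..x, gExt v t := fun a =>
    intervalIntegral.continuous_primitive
      (intervalIntegrable_of_locallyIntegrable (locallyIntegrable_gExt v)) a
  have hset : {x : ℝ | 1 ≤ |x|} = Set.Ici 1 ∪ Set.Iic (-1) := by
    ext x; simp only [Set.mem_ofPred_eq, le_abs, Set.mem_union, Set.mem_Ici, Set.mem_Iic]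
    constructor <;> rintro (h | h)
    · exact Or.inl h
    · exact Or.inr (by linarith)
    · exact Or.inl h
    · exact Or.inr (by linarith)
  rw [hset]
  refine ContinuousOn.union_of_isClosed ?_ ?_ isClosed_Ici isClosed_Iic
  · exact (continuous_const.add (hc 1)).continuousOn.congr fun x hx => h.right x hx
  · exact (continuous_const.add (hc (-1))).continuousOn.congr fun x hx => h.left x hx

theorem exists_isContRep (v : W12 freeSurface) : ∃ w : ℝ → ℂ, IsContRep v w := by
  obtain ⟨c, hc⟩ := exists_ae_eq_const_add_primitive measurableSet_freeSurface isOpen_Ioi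
    Set.ordConnected_Ioi Set.nonempty_Ioi Ioi_one_subset_freeSurface v 1
  obtain ⟨d, hd⟩ := exists_ae_eq_const_add_primitive measurableSet_freeSurface isOpen_Iio
    Set.ordConnected_Iio Set.nonempty_Iio Iio_neg_one_subset_freeSurface v (-1)
  -- The constants on the two half-lines are unrelated. The sign of x selects the branch, and the
  -- values on (-1, 1) are immaterial.
  refine ⟨fun x => if 0 < x then c + ∫ t in (1 : ℝ)..x, gExt v t
    else d + ∫ t in (-1 : ℝ)..x, gExt v t, ?_, fun x hx => ?_, fun x hx => ?_⟩
  · refine (ae_restrict_iff' measurableSet_freeSurface).2 ?_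
    filter_upwards [hc, hd] with x h1 h2 hx
    rcases lt_abs.1 (show 1 < |x| from hx) with h | h
    · rw [if_pos (by linarith)]; exact h1 h
    · rw [if_neg (by linarith)]; exact h2 (by simp only [Set.mem_Iio]; linarith)
  · simp only [if_pos (show 0 < x by linarith), zero_lt_one, if_true,
      intervalIntegral.integral_same, add_zero]
  · simp only [if_neg (show ¬0 < x by linarith), show ¬(0 : ℝ) < -1 by norm_num, if_false,
      intervalIntegral.integral_same, add_zero]

theorem intervalIntegral_valFn_eq {v : W12 freeSurface} {w : ℝ → ℂ} (h : IsContRep v w) {a b : ℝ}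
    (hab : a ≤ b) (hs : Set.Ioo a b ⊆ freeSurface) :
    ∫ x in a..b, w x = ∫ x in Set.Ioo a b, valFn v x := by
  rw [intervalIntegral.integral_of_le hab, integral_Ioc_eq_integral_Ioo]
  refine setIntegral_congr_ae measurableSet_Ioo ?_
  filter_upwards [(ae_restrict_iff' measurableSet_freeSurface).1 h.ae_eq] with x hx hxI
  exact (hx (hs hxI)).symm

/-- Integration by parts against x - 2, which has derivative 1 and vanishes at 2, leaves only the
boundary value at 1. The right side is visibly bounded in the W^{1,2} norm. -/
theorem IsContRep.apply_one {v : W12 freeSurface} {w : ℝ → ℂ} (h : IsContRep v w) :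
    w 1 = (∫ x in Set.Ioo (1 : ℝ) 2, valFn v x)
      + ∫ x in Set.Ioo (1 : ℝ) 2, weakDeriv v x * (x - 2) := by
  have hs : Set.Ioo (1 : ℝ) 2 ⊆ freeSurface := fun x hx => Ioi_one_subset_freeSurface hx.1
  have hφ : ContDiff ℝ 1 fun x : ℝ => (x : ℂ) - 2 := Complex.ofRealCLM.contDiff.sub contDiff_const
  have hd : deriv (fun x : ℝ => (x : ℂ) - 2) = fun _ => 1 := by
    funext x; exact ((Complex.ofRealCLM.hasDerivAt).sub_const 2).deriv
  have hF := locallyIntegrable_gExt v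
  have hW : Continuous fun x => ∫ t in (1 : ℝ)..x, gExt v t :=
    intervalIntegral.continuous_primitive (intervalIntegrable_of_locallyIntegrable hF) 1
  have h1 := integral_primitive_mul_deriv hF hφ 1 2 1
  rw [hd] at h1
  simp only [mul_one, intervalIntegral.integral_same, zero_mul, Complex.ofReal_ofNat,
    sub_self, mul_zero, zero_sub] at h1
  have h2 : ∫ x in (1 : ℝ)..2, w x = ∫ x in (1 : ℝ)..2, (w 1 + ∫ t in (1 : ℝ)..x, gExt v t) := by
    refine intervalIntegral.integral_congr fun x hx => ?_
    rw [Set.uIcc_of_le one_le_two] at hx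
    exact h.right x hx.1
  have h3 : ∫ t in (1 : ℝ)..2, gExt v t * (t - 2)
      = ∫ x in Set.Ioo (1 : ℝ) 2, weakDeriv v x * (x - 2) := by
    rw [intervalIntegral.integral_of_le one_le_two, integral_Ioc_eq_integral_Ioo]
    refine setIntegral_congr_fun measurableSet_Ioo fun x hx => ?_
    simp only [gExt, Set.indicator_of_mem (hs hx)]
  rw [← intervalIntegral_valFn_eq h one_le_two hs, ← h3, h2,
    intervalIntegral.integral_add (by simp) (hW.intervalIntegrable _ _), h1,
    intervalIntegral.integral_const]
  norm_num

/-- The mirror image, with x + 2 vanishing at the far end -2. -/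
theorem IsContRep.apply_neg_one {v : W12 freeSurface} {w : ℝ → ℂ} (h : IsContRep v w) :
    w (-1) = (∫ x in Set.Ioo (-2 : ℝ) (-1), valFn v x)
      + ∫ x in Set.Ioo (-2 : ℝ) (-1), weakDeriv v x * (x + 2) := by
  have hle : (-2 : ℝ) ≤ -1 := by norm_num
  have hs : Set.Ioo (-2 : ℝ) (-1) ⊆ freeSurface := fun x hx => Iio_neg_one_subset_freeSurface hx.2
  have hφ : ContDiff ℝ 1 fun x : ℝ => (x : ℂ) + 2 := Complex.ofRealCLM.contDiff.add contDiff_const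
  have hd : deriv (fun x : ℝ => (x : ℂ) + 2) = fun _ => 1 := by
    funext x; exact ((Complex.ofRealCLM.hasDerivAt).add_const 2).deriv
  have hF := locallyIntegrable_gExt v
  have hW : Continuous fun x => ∫ t in (-1 : ℝ)..x, gExt v t :=
    intervalIntegral.continuous_primitive (intervalIntegrable_of_locallyIntegrable hF) (-1)
  have h1 := integral_primitive_mul_deriv hF hφ (-2) (-1) (-1)
  rw [hd] at h1
  simp only [mul_one, intervalIntegral.integral_same, zero_mul, Complex.ofReal_neg,
    Complex.ofReal_ofNat, neg_add_cancel, mul_zero, sub_self, zero_sub] at h1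
  have h2 : ∫ x in (-2 : ℝ)..(-1), w x
      = ∫ x in (-2 : ℝ)..(-1), (w (-1) + ∫ t in (-1 : ℝ)..x, gExt v t) := by
    refine intervalIntegral.integral_congr fun x hx => ?_
    rw [Set.uIcc_of_le hle] at hx
    exact h.left x hx.2
  have h3 : ∫ t in (-2 : ℝ)..(-1), gExt v t * (t + 2)
      = ∫ x in Set.Ioo (-2 : ℝ) (-1), weakDeriv v x * (x + 2) := by
    rw [intervalIntegral.integral_of_le hle, integral_Ioc_eq_integral_Ioo]
    refine setIntegral_congr_fun measurableSet_Ioo fun x hx => ?_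
    simp only [gExt, Set.indicator_of_mem (hs hx)]
  rw [← intervalIntegral_valFn_eq h hle hs, ← h3, h2,
    intervalIntegral.integral_add (by simp) (hW.intervalIntegrable _ _), h1,
    intervalIntegral.integral_const]
  norm_num

/-- The weak derivative as a bounded operator. -/
noncomputable def weakDerivCLM (U : Set ℝ) : W12 U →L[ℂ] L2 U :=
  (WithLp.sndL 2 ℂ (L2 U) (L2 U)) ∘L (W12 U).subtypeL

/-- The inclusion of `W^{1,2}(U)` into `L²(U)` as a bounded operator. -/
noncomputable def valFnCLM (U : Set ℝ) : W12 U →L[ℂ] L2 U :=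
  (WithLp.fstL 2 ℂ (L2 U) (L2 U)) ∘L (W12 U).subtypeL

theorem exists_clm_setIntegral_mul {s : Set ℝ} (hs : MeasurableSet s) (hsE : s ⊆ freeSurface)
    {k : ℝ → ℂ} (hk : MemLp k 2 (volume.restrict s)) :
    ∃ T : L2 freeSurface →L[ℂ] ℂ, ∀ v : L2 freeSurface, T v = ∫ x in s, v x * k x := by
  have hk' : MemLp (s.indicator k) 2 (volume.restrict freeSurface) := by
    rw [memLp_indicator_iff_restrict hs, Measure.restrict_restrict hs,
      Set.inter_eq_left.2 hsE]
    exact hk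
  refine ⟨((ContinuousLinearMap.mul ℂ ℂ).lpPairing _ 2 2).flip (hk'.toLp _), fun v => ?_⟩
  have e : ∫ x in s, v x * k x = ∫ x in freeSurface, s.indicator (fun x => v x * k x) x := by
    rw [integral_indicator hs, Measure.restrict_restrict hs, Set.inter_eq_left.2 hsE]
  rw [ContinuousLinearMap.flip_apply, ContinuousLinearMap.lpPairing_eq_integral, e]
  refine integral_congr_ae ?_
  filter_upwards [hk'.coeFn_toLp] with x hx
  rw [hx, ContinuousLinearMap.mul_apply']
  by_cases h : x ∈ s
  · simp [h]
  · simp [h]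

/-- The jump `v(1) - v(-1)` is a bounded functional of `v ∈ W^{1,2}(ℰ)`. -/
theorem exists_clm_trace_sub : ∃ T : W12 freeSurface →L[ℂ] ℂ, ∀ (v : W12 freeSurface) (w : ℝ → ℂ),
    IsContRep v w → T v = w 1 - w (-1) := by
  have hs1 : Set.Ioo (1 : ℝ) 2 ⊆ freeSurface := fun x hx => Ioi_one_subset_freeSurface hx.1
  have hs2 : Set.Ioo (-2 : ℝ) (-1) ⊆ freeSurface := fun x hx => Iio_neg_one_subset_freeSurface hx.2
  have hmem : ∀ (a b : ℝ) (k : ℝ → ℂ), Continuous k → MemLp k 2 (volume.restrict (Set.Ioo a b)) := by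
    intro a b k hk
    have h1 : MemLp k 2 (volume.restrict (Set.Icc a b)) := by
      obtain ⟨C, hC⟩ := isCompact_Icc.exists_bound_of_continuousOn (s := Set.Icc a b) hk.continuousOn
      exact MemLp.of_bound hk.aestronglyMeasurable C
        ((ae_restrict_iff' measurableSet_Icc).2 (Eventually.of_forall hC))
    exact h1.mono_measure (Measure.restrict_mono Set.Ioo_subset_Icc_self le_rfl)
  obtain ⟨A, hA⟩ := exists_clm_setIntegral_mul measurableSet_Ioo hs1 (hmem 1 2 (fun _ => 1) continuous_const)
  obtain ⟨B, hB⟩ := exists_clm_setIntegral_mul measurableSet_Ioo hs1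
    (hmem 1 2 (fun x => (x : ℂ) - 2) (by fun_prop))
  obtain ⟨C, hC⟩ := exists_clm_setIntegral_mul measurableSet_Ioo hs2
    (hmem (-2) (-1) (fun _ => 1) continuous_const)
  obtain ⟨D, hD⟩ := exists_clm_setIntegral_mul measurableSet_Ioo hs2
    (hmem (-2) (-1) (fun x => (x : ℂ) + 2) (by fun_prop))
  refine ⟨(A ∘L valFnCLM _ + B ∘L weakDerivCLM _) - (C ∘L valFnCLM _ + D ∘L weakDerivCLM _),
    fun v w h => ?_⟩
  have h1 : valFnCLM freeSurface v = valFn v := rfl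
  have h2 : weakDerivCLM freeSurface v = weakDeriv v := rfl
  rw [h.apply_one, h.apply_neg_one]
  simp only [sub_apply, add_apply,
    ContinuousLinearMap.comp_apply, h1, h2, hA, hB, hC, hD, mul_one]

/-! ### Locality of the weak derivative and density of V₀(ℰ) -/

/-- The weak derivative vanishes on open sets where the function vanishes. -/
theorem weakDeriv_ae_eq_zero {U V : Set ℝ} (hU : MeasurableSet U) (hV : IsOpen V) (hVU : V ⊆ U)
    (v : W12 U) (h : ∀ᵐ x, x ∈ V → valFn v x = 0) : ∀ᵐ x, x ∈ V → weakDeriv v x = 0 := by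
  have key := hV.ae_eq_zero_of_integral_contDiff_smul_eq_zero (f := U.indicator (weakDeriv v))
    (μ := volume)
    (((memLp_indicator_L2 hU (weakDeriv v)).locallyIntegrable (by norm_num)).locallyIntegrableOn V) ?_
  · filter_upwards [key] with x hx hxV
    rw [← hx hxV, Set.indicator_of_mem (hVU hxV)]
  intro g hg hgc hgs
  have hts : tsupport (fun x => (g x : ℂ)) ⊆ tsupport g :=
    closure_mono fun x hx => fun h0 => hx (by simp only; rw [h0, Complex.ofReal_zero])
  have hgC : ContDiff ℝ ∞ fun x => (g x : ℂ) := Complex.ofRealCLM.contDiff.comp hg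
  have hgCc : HasCompactSupport fun x => (g x : ℂ) := hgc.comp_left Complex.ofReal_zero
  have h1 : ∫ x in U, valFn v x * deriv (fun x => (g x : ℂ)) x
      = -∫ x in U, weakDeriv v x * (g x : ℂ) := v.2 _ hgC hgCc ((hts.trans hgs).trans hVU)
  have h2 : ∫ x in U, valFn v x * deriv (fun x => (g x : ℂ)) x = 0 := by
    refine integral_eq_zero_of_ae ?_
    filter_upwards [ae_restrict_of_ae h] with x hx
    by_cases hxV : x ∈ V
    · simp [hx hxV]
    · have : deriv (fun x => (g x : ℂ)) x = 0 :=
        Function.notMem_support.1 fun hd => hxV (hgs (hts (support_deriv_subset hd)))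
      simp [this]
  rw [h2, zero_eq_neg, ← integral_indicator_mul hU] at h1
  rw [← h1]
  refine integral_congr_ae (Eventually.of_forall fun x => ?_)
  simp only [Complex.real_smul]; ring

theorem ae_of_ae_restrict_univ {p : ℝ → Prop}
    (h : ∀ᵐ x ∂((volume : Measure ℝ).restrict Set.univ), p x) : ∀ᵐ x : ℝ, p x := by
  rwa [Measure.restrict_univ] at h

/-- Locality applied to the difference. It makes `IsLambdaOmega` independent of the element `u`
representing η(v). -/
theorem weakDeriv_congr (u₁ u₂ : W12 Set.univ) (h : ∀ᵐ x : ℝ, valFn u₁ x = valFn u₂ x) :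
    ∀ᵐ x : ℝ, weakDeriv u₁ x = weakDeriv u₂ x := by
  have e1 : valFn (u₁ - u₂) = valFn u₁ - valFn u₂ := rfl
  have e2 : weakDeriv (u₁ - u₂) = weakDeriv u₁ - weakDeriv u₂ := rfl
  have a1 := ae_of_ae_restrict_univ (Lp.coeFn_sub (valFn u₁) (valFn u₂))
  have a2 := ae_of_ae_restrict_univ (Lp.coeFn_sub (weakDeriv u₁) (weakDeriv u₂))
  have := weakDeriv_ae_eq_zero MeasurableSet.univ isOpen_univ subset_rfl (u₁ - u₂) (by
    filter_upwards [h, a1] with x hx h1 _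
    rw [e1, h1, Pi.sub_apply, hx, sub_self])
  filter_upwards [this, a2] with x hx h2
  have := hx trivial
  rw [e2, h2, Pi.sub_apply] at this
  exact sub_eq_zero.1 this

theorem norm_W12_le {U : Set ℝ} (u : W12 U) : ‖u‖ ≤ ‖valFn u‖ + ‖weakDeriv u‖ := by
  have h : ‖u‖ = ‖(u : WithLp 2 (L2 U × L2 U))‖ := rfl
  rw [h, WithLp.prod_norm_eq_of_L2]
  refine Real.sqrt_le_iff.2 ⟨by positivity, ?_⟩
  change ‖valFn u‖ ^ 2 + ‖weakDeriv u‖ ^ 2 ≤ _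
  nlinarith [norm_nonneg (valFn u), norm_nonneg (weakDeriv u)]

theorem memLp_mul_of_bound {μ : Measure ℝ} {χ f : ℝ → ℂ} (hχ : Continuous χ) {A : ℝ}
    (hA : ∀ x, ‖χ x‖ ≤ A) (hf : MemLp f 2 μ) : MemLp (fun x => χ x * f x) 2 μ :=
  hf.mul (memLp_top_of_bound hχ.aestronglyMeasurable A (Eventually.of_forall hA))

/-- The product of an element of `W^{1,2}(U)` and a smooth function with bounded derivative. -/
theorem exists_W12_mul {U : Set ℝ} (v : W12 U) {χ : ℝ → ℂ} (hχ : ContDiff ℝ ∞ χ) {A B : ℝ}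
    (hA : ∀ x, ‖χ x‖ ≤ A) (hB : ∀ x, ‖deriv χ x‖ ≤ B) :
    ∃ u : W12 U, (∀ᵐ x ∂(volume.restrict U), valFn u x = χ x * valFn v x) ∧
      ∀ᵐ x ∂(volume.restrict U), weakDeriv u x = χ x * weakDeriv v x + deriv χ x * valFn v x := by
  have hd : Continuous (deriv χ) := hχ.continuous_deriv (by simp)
  have h1 := memLp_mul_of_bound hχ.continuous hA (Lp.memLp (valFn v))
  have h2 := (memLp_mul_of_bound hχ.continuous hA (Lp.memLp (weakDeriv v))).add
    (memLp_mul_of_bound hd hB (Lp.memLp (valFn v)))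
  have hw : IsWeakDeriv U (h1.toLp _) (h2.toLp _) := by
    intro φ hφ hφc hφs
    have hφd : Continuous (deriv φ) := hφ.continuous_deriv (by simp)
    have hts : tsupport (fun x => χ x * φ x) ⊆ tsupport φ :=
      closure_mono fun x hx h0 => hx (by simp only; rw [h0, mul_zero])
    have hv : ∫ x in U, valFn v x * deriv (fun x => χ x * φ x) x
        = -∫ x in U, weakDeriv v x * (χ x * φ x) :=
      v.2 _ (hχ.mul hφ) hφc.mul_left (hts.trans hφs)
    have hder : ∀ x, deriv (fun x => χ x * φ x) x = deriv χ x * φ x + χ x * deriv φ x := fun x =>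
      deriv_fun_mul (hχ.differentiable (by simp)).differentiableAt
        (hφ.differentiable (by simp)).differentiableAt
    have i1 : Integrable (fun x => valFn v x * (deriv χ x * φ x)) (volume.restrict U) :=
      integrable_mul_test _ (hd.mul hφ.continuous) hφc.mul_left
    have i2 : Integrable (fun x => valFn v x * (χ x * deriv φ x)) (volume.restrict U) :=
      integrable_mul_test _ (hχ.continuous.mul hφd) hφc.deriv.mul_left
    have i3 : Integrable (fun x => weakDeriv v x * (χ x * φ x)) (volume.restrict U) :=
      integrable_mul_test _ (hχ.continuous.mul hφ.continuous) hφc.mul_left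
    simp_rw [hder, mul_add] at hv
    rw [integral_add i1 i2] at hv
    have e1 : ∫ x in U, h1.toLp _ x * deriv φ x = ∫ x in U, valFn v x * (χ x * deriv φ x) := by
      refine integral_congr_ae ?_
      filter_upwards [h1.coeFn_toLp] with x hx
      rw [hx]; ring
    have e2 : ∫ x in U, h2.toLp _ x * φ x
        = (∫ x in U, weakDeriv v x * (χ x * φ x)) + ∫ x in U, valFn v x * (deriv χ x * φ x) := by
      rw [← integral_add i3 i1]
      refine integral_congr_ae ?_
      filter_upwards [h2.coeFn_toLp] with x hx
      rw [hx, Pi.add_apply]; ring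
    rw [e1, e2]
    linear_combination hv
  exact ⟨⟨WithLp.toLp 2 (h1.toLp _, h2.toLp _), hw⟩, h1.coeFn_toLp, h2.coeFn_toLp⟩

theorem tendsto_eLpNorm_mul_zero {μ : Measure ℝ} {f : ℝ → ℂ} (hf : MemLp f 2 μ)
    {k : ℕ → ℝ → ℂ} (hk : ∀ n, Continuous (k n)) (hk1 : ∀ n x, ‖k n x‖ ≤ 1)
    (hk0 : ∀ x, Tendsto (fun n => k n x) atTop (𝓝 0)) :
    Tendsto (fun n => eLpNorm (fun x => k n x * f x) 2 μ) atTop (𝓝 0) := by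
  have hmulint : ∫⁻ x, ‖f x‖ₑ ^ (2 : ℝ) ∂μ ≠ ⊤ := by
    have := lintegral_rpow_enorm_lt_top_of_eLpNorm_lt_top two_ne_zero ENNReal.ofNat_ne_top hf.2
    simpa using this.ne
  have h := tendsto_lintegral_of_dominated_convergence' (μ := μ)
    (F := fun n x => ‖k n x * f x‖ₑ ^ (2 : ℝ)) (f := fun _ => 0) (fun x => ‖f x‖ₑ ^ (2 : ℝ))
    (fun n => ((hk n).aestronglyMeasurable.mul hf.1).enorm.pow_const 2)
    (fun n => Eventually.of_forall fun x => ?_) hmulint (Eventually.of_forall fun x => ?_)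
  · simp_rw [eLpNorm_eq_lintegral_rpow_enorm_toReal two_ne_zero ENNReal.ofNat_ne_top]
    rw [lintegral_zero] at h
    have h2 := h.ennrpow_const (1 / 2)
    simpa using h2
  · have hle : ‖k n x * f x‖ₑ ≤ ‖f x‖ₑ := by
      rw [enorm_le_iff_norm_le, norm_mul]
      exact mul_le_of_le_one_left (norm_nonneg _) (hk1 n x)
    exact ENNReal.rpow_le_rpow hle (by norm_num)
  · have h1 : Tendsto (fun n => ‖k n x * f x‖ₑ) atTop (𝓝 0) := by
      have := ((hk0 x).mul_const (f x)).enorm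
      simpa using this
    have h2 := h1.ennrpow_const 2
    simpa using h2

/-- Compactly supported elements are dense in `W^{1,2}(ℰ)`. -/
theorem exists_seq_memV0_tendsto (v : W12 freeSurface) :
    ∃ u : ℕ → W12 freeSurface, (∀ n, MemV0 (u n)) ∧ Tendsto u atTop (𝓝 v) := by
  let β : ContDiffBump (0 : ℝ) := ⟨1, 2, one_pos, one_lt_two⟩
  have hβ : ContDiff ℝ ∞ β := β.contDiff
  have hβd : Continuous (deriv β) := hβ.continuous_deriv (by simp)
  obtain ⟨C, hC⟩ := hβd.bounded_above_of_compact_support β.hasCompactSupport.deriv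
  have hn0 : ∀ n : ℕ, (0 : ℝ) < n + 1 := fun n => by positivity
  -- Stretched cutoffs: equal to 1 on [-(n+1), n+1], with derivative of size O(1/n).
  set χ : ℕ → ℝ → ℂ := fun n x => (β (x / (n + 1)) : ℂ) with hχdef
  have hχ : ∀ n, ContDiff ℝ ∞ (χ n) := fun n =>
    Complex.ofRealCLM.contDiff.comp (β.contDiff.comp (contDiff_id.div_const _))
  have hχ01 : ∀ n x, ‖χ n x‖ ≤ 1 := fun n x => by
    rw [hχdef, Complex.norm_real, Real.norm_of_nonneg β.nonneg]; exact β.le_one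
  have hχd : ∀ n x, deriv (χ n) x = ((deriv β (x / (n + 1)) * (1 / (n + 1)) : ℝ) : ℂ) := by
    intro n x
    have h1 : HasDerivAt (fun x : ℝ => x / ((n : ℝ) + 1)) (1 / ((n : ℝ) + 1)) x :=
      (hasDerivAt_id x).div_const _
    have h2 : HasDerivAt β (deriv β (x / (n + 1))) (x / ((n : ℝ) + 1)) :=
      (hβ.differentiable (by simp)).differentiableAt.hasDerivAt
    exact (h2.comp x h1).ofReal_comp.deriv
  have hχdb : ∀ n x, ‖deriv (χ n) x‖ ≤ C * (1 / (n + 1)) := by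
    intro n x
    rw [hχd, Complex.norm_real, norm_mul, Real.norm_of_nonneg (by positivity : (0:ℝ) ≤ 1 / (n + 1))]
    gcongr
    exact hC _
  choose u hu1 hu2 using fun n => exists_W12_mul v (hχ n) (hχ01 n) (hχdb n)
  refine ⟨u, fun n => ⟨Metric.closedBall 0 (2 * (n + 1)), isCompact_closedBall _ _, ?_⟩, ?_⟩
  · filter_upwards [hu1 n] with x hx hxK
    have : β (x / (n + 1)) = 0 := by
      refine β.zero_of_le_dist ?_
      rw [Metric.mem_closedBall, not_le, dist_zero_right, Real.norm_eq_abs] at hxK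
      rw [dist_zero_right, Real.norm_eq_abs, abs_div, abs_of_pos (hn0 n)]
      exact ((lt_div_iff₀ (hn0 n)).2 hxK).le
    rw [hx, hχdef]
    simp only [this, Complex.ofReal_zero, zero_mul]
  have hk0 : ∀ x, Tendsto (fun n => χ n x - 1) atTop (𝓝 0) := by
    intro x
    refine tendsto_const_nhds.congr' ?_
    filter_upwards [eventually_ge_atTop ⌈|x|⌉₊] with n hn
    have hx : |x| ≤ n := (Nat.le_ceil _).trans (by exact_mod_cast hn)
    have : β (x / (n + 1)) = 1 := by
      refine β.one_of_mem_closedBall ?_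
      rw [Metric.mem_closedBall, dist_zero_right, Real.norm_eq_abs, abs_div, abs_of_pos (hn0 n)]
      exact (div_le_one (hn0 n)).2 (by linarith)
    simp only [hχdef, this, Complex.ofReal_one, sub_self]
  have hk1 : ∀ n x, ‖χ n x - 1‖ ≤ 1 := by
    intro n x
    have : χ n x - 1 = ((β (x / (n + 1)) - 1 : ℝ) : ℂ) := by simp [hχdef]
    rw [this, Complex.norm_real, Real.norm_eq_abs, abs_le]
    constructor <;> linarith [β.nonneg (x := x / ((n : ℝ) + 1)), β.le_one (x := x / ((n : ℝ) + 1))]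
  have hkc : ∀ n, Continuous fun x => χ n x - 1 := fun n => (hχ n).continuous.sub continuous_const
  have hlim : ∀ f : L2 freeSurface, Tendsto (fun n => (eLpNorm (fun x => (χ n x - 1) * f x) 2
      (volume.restrict freeSurface)).toReal) atTop (𝓝 0) := fun f => by
    simpa [Function.comp_def] using (ENNReal.tendsto_toReal ENNReal.zero_ne_top).comp
      (tendsto_eLpNorm_mul_zero (Lp.memLp f) hkc hk1 hk0)
  rw [tendsto_iff_norm_sub_tendsto_zero]
  have hb : Tendsto (fun n : ℕ => C * (1 / ((n : ℝ) + 1)) * ‖valFn v‖) atTop (𝓝 0) := by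
    simpa using (tendsto_one_div_add_atTop_nhds_zero_nat.const_mul C).mul_const ‖valFn v‖
  -- The errors of the cutoff are (χ - 1) v in the function and (χ - 1) v' + χ' v in the derivative.
  -- The first two vanish by dominated convergence, the last by the bound on χ'.
  have htot := ((hlim (valFn v)).add ((hlim (weakDeriv v)).add hb))
  simp only [add_zero] at htot
  refine squeeze_zero (fun _ => norm_nonneg _) (fun n => ?_) htot
  refine (norm_W12_le _).trans (add_le_add ?_ ?_)
  · have e : valFn (u n - v) = valFn (u n) - valFn v := rfl
    rw [e, Lp.norm_def]
    refine le_of_eq (congrArg _ (eLpNorm_congr_ae ?_))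
    filter_upwards [Lp.coeFn_sub (valFn (u n)) (valFn v), hu1 n] with x h1 h2
    rw [h1, Pi.sub_apply, h2]; ring
  · have e : weakDeriv (u n - v) = weakDeriv (u n) - weakDeriv v := rfl
    have m1 := memLp_mul_of_bound (hkc n) (hk1 n) (Lp.memLp (weakDeriv v))
    have m2 := memLp_mul_of_bound ((hχ n).continuous_deriv (by simp)) (hχdb n) (Lp.memLp (valFn v))
    have e2 : weakDeriv (u n) - weakDeriv v = m1.toLp _ + m2.toLp _ := by
      refine Lp.ext ?_
      filter_upwards [Lp.coeFn_sub (weakDeriv (u n)) (weakDeriv v), hu2 n,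
        Lp.coeFn_add (m1.toLp _) (m2.toLp _), m1.coeFn_toLp, m2.coeFn_toLp] with x h1 h2 h3 h4 h5
      rw [h1, h3, Pi.sub_apply, Pi.add_apply, h2, h4, h5]; ring
    rw [e, e2]
    refine (norm_add_le _ _).trans (add_le_add (le_of_eq (Lp.norm_toLp _ m1)) ?_)
    refine Lp.norm_le_mul_norm_of_ae_le_mul ?_
    filter_upwards [m2.coeFn_toLp] with x hx
    rw [hx, norm_mul]
    gcongr
    exact hχdb n x

/-! ### The inversion x ↦ 1/x and bounded operators on L² -/

theorem hasDerivWithinAt_inv_compl (x : ℝ) (hx : x ∈ ({0} : Set ℝ)ᶜ) :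
    HasDerivWithinAt (fun x : ℝ => x⁻¹) (-(x ^ 2)⁻¹) {0}ᶜ x :=
  (hasDerivAt_inv hx).hasDerivWithinAt

theorem image_inv_compl_zero : (fun x : ℝ => x⁻¹) '' {0}ᶜ = {0}ᶜ := by
  ext y
  simp only [Set.mem_image, Set.mem_compl_iff, Set.mem_singleton_iff]
  exact ⟨fun ⟨x, hx, h⟩ => h ▸ inv_ne_zero hx, fun h => ⟨y⁻¹, inv_ne_zero h, inv_inv y⟩⟩

/-- Away from 0 the inversion is differentiable and its own inverse, so preimages of null sets are
null up to the point 0. Almost everywhere statements may thus be evaluated at 1/x. -/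
theorem quasiMeasurePreserving_one_div :
    Measure.QuasiMeasurePreserving (fun x : ℝ => 1 / x) volume volume := by
  refine ⟨by fun_prop, Measure.AbsolutelyContinuous.mk fun s hs h0 => ?_⟩
  rw [Measure.map_apply (by fun_prop) hs]
  have h1 : volume ((fun x : ℝ => x⁻¹) '' (s \ {0})) = 0 := by
    refine addHaar_image_eq_zero_of_differentiableOn_of_addHaar_eq_zero volume
      (fun x hx => ((hasDerivAt_inv hx.2).differentiableAt).differentiableWithinAt)
      (measure_mono_null Set.sdiff_subset h0)
  refine measure_mono_null (t := ((fun x : ℝ => x⁻¹) '' (s \ {0})) ∪ {0}) (fun x hx => ?_)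
    (measure_union_null h1 (by simp))
  by_cases h : x = 0
  · exact Or.inr h
  · refine Or.inl ⟨x⁻¹, ⟨?_, inv_ne_zero h⟩, inv_inv x⟩
    have : 1 / x ∈ s := hx
    rwa [one_div] at this

theorem ae_comp_one_div {p : ℝ → Prop} (h : ∀ᵐ x : ℝ, p x) : ∀ᵐ x : ℝ, p (1 / x) :=
  quasiMeasurePreserving_one_div.ae h

theorem lintegral_comp_one_div (G : ℝ → ENNReal) :
    ∫⁻ t : ℝ, ENNReal.ofReal (1 / t ^ 2) * G (1 / t) = ∫⁻ s, G s := by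
  have h := lintegral_image_eq_lintegral_abs_deriv_mul (measurableSet_singleton (0 : ℝ)).compl
    hasDerivWithinAt_inv_compl inv_injective.injOn G
  rw [image_inv_compl_zero, restrict_compl_singleton] at h
  rw [h]
  refine lintegral_congr fun t => ?_
  rw [abs_neg, abs_of_nonneg (by positivity), one_div, one_div]

theorem integral_comp_one_div (G : ℝ → ℂ) :
    ∫ t : ℝ, (1 / (t : ℂ) ^ 2) * G (1 / t) = ∫ s, G s := by
  have h := integral_image_eq_integral_abs_deriv_smul (measurableSet_singleton (0 : ℝ)).compl
    hasDerivWithinAt_inv_compl inv_injective.injOn G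
  rw [image_inv_compl_zero, restrict_compl_singleton] at h
  rw [h]
  refine integral_congr_ae (Eventually.of_forall fun t => ?_)
  simp only
  rw [abs_neg, abs_of_nonneg (by positivity), one_div, one_div, Complex.real_smul]
  push_cast; rfl

/-- The weight t⁻¹ is chosen so that its square is the Jacobian t⁻² of the inversion. -/
theorem eLpNorm_inversion (f : ℝ → ℂ) :
    eLpNorm (fun t : ℝ => (1 / (t : ℂ)) * f (1 / t)) 2 volume = eLpNorm f 2 volume := by
  rw [eLpNorm_eq_lintegral_rpow_enorm_toReal two_ne_zero ENNReal.ofNat_ne_top,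
    eLpNorm_eq_lintegral_rpow_enorm_toReal two_ne_zero ENNReal.ofNat_ne_top,
    ← lintegral_comp_one_div fun s => ‖f s‖ₑ ^ (2 : ENNReal).toReal]
  congr 1
  refine lintegral_congr fun t => ?_
  rw [enorm_mul, ENNReal.mul_rpow_of_nonneg _ _ (by simp)]
  congr 1
  rw [← ofReal_norm, norm_div, norm_one, Complex.norm_real,
    ENNReal.ofReal_rpow_of_nonneg (by positivity) (by simp)]
  congr 1
  simp

theorem memLp_inversion {f : ℝ → ℂ} (hf : MemLp f 2 volume) :
    MemLp (fun t : ℝ => (1 / (t : ℂ)) * f (1 / t)) 2 volume := by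
  refine ⟨?_, (eLpNorm_inversion f).trans_lt hf.2⟩
  refine AEStronglyMeasurable.mul (Measurable.aestronglyMeasurable (by fun_prop)) ?_
  exact hf.1.comp_quasiMeasurePreserving quasiMeasurePreserving_one_div

/-- A linear, norm-nonincreasing assignment of functions defines a bounded operator on `L²`. -/
theorem exists_clm_of_eLpNorm_le {μ ν : Measure ℝ} (T : Lp ℂ 2 μ → ℝ → ℂ)
    (hm : ∀ f, AEStronglyMeasurable (T f) ν) (hb : ∀ f, eLpNorm (T f) 2 ν ≤ eLpNorm f 2 μ)
    (hadd : ∀ f g, ∀ᵐ x ∂ν, T (f + g) x = T f x + T g x)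
    (hsmul : ∀ (c : ℂ) f, ∀ᵐ x ∂ν, T (c • f) x = c * T f x) :
    ∃ S : Lp ℂ 2 μ →L[ℂ] Lp ℂ 2 ν, ∀ f, ∀ᵐ x ∂ν, S f x = T f x := by
  have hmem : ∀ f, MemLp (T f) 2 ν := fun f => ⟨hm f, (hb f).trans_lt (Lp.memLp f).2⟩
  let S : Lp ℂ 2 μ →ₗ[ℂ] Lp ℂ 2 ν :=
    { toFun := fun f => (hmem f).toLp (T f)
      map_add' := fun f g => by
        refine Lp.ext ?_
        filter_upwards [(hmem (f + g)).coeFn_toLp, (hmem f).coeFn_toLp, (hmem g).coeFn_toLp,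
          Lp.coeFn_add ((hmem f).toLp (T f)) ((hmem g).toLp (T g)), hadd f g] with x h1 h2 h3 h4 h5
        rw [h1, h4, Pi.add_apply, h2, h3, h5]
      map_smul' := fun c f => by
        refine Lp.ext ?_
        filter_upwards [(hmem (c • f)).coeFn_toLp, (hmem f).coeFn_toLp,
          Lp.coeFn_smul c ((hmem f).toLp (T f)), hsmul c f] with x h1 h2 h3 h4
        rw [h1, RingHom.id_apply, h3, Pi.smul_apply, h2, h4, smul_eq_mul] }
  refine ⟨S.mkContinuous 1 fun f => ?_, fun f => (hmem f).coeFn_toLp⟩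
  rw [one_mul]
  change ‖(hmem f).toLp (T f)‖ ≤ ‖f‖
  rw [Lp.norm_toLp, Lp.norm_def]
  exact ENNReal.toReal_mono (Lp.memLp f).2.ne (hb f)

theorem exists_clm_extend : ∃ S : L2 freeSurface →L[ℂ] Lp ℂ 2 (volume : Measure ℝ),
    ∀ f, ∀ᵐ x, S f x = freeSurface.indicator f x := by
  refine exists_clm_of_eLpNorm_le (fun f => freeSurface.indicator f)
    (fun f => (memLp_indicator_L2 measurableSet_freeSurface f).1)
    (fun f => (eLpNorm_indicator_eq_eLpNorm_restrict measurableSet_freeSurface).le)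
    (fun f g => ?_) (fun c f => ?_)
  · filter_upwards [(ae_restrict_iff' measurableSet_freeSurface).1 (Lp.coeFn_add f g)] with x hx
    by_cases h : x ∈ freeSurface
    · simp only [Set.indicator_of_mem h]; exact hx h
    · simp [Set.indicator_of_notMem h]
  · filter_upwards [(ae_restrict_iff' measurableSet_freeSurface).1 (Lp.coeFn_smul c f)] with x hx
    by_cases h : x ∈ freeSurface
    · simp only [Set.indicator_of_mem h]; exact hx h
    · simp [Set.indicator_of_notMem h]

theorem exists_clm_restrict : ∃ S : Lp ℂ 2 (volume : Measure ℝ) →L[ℂ] L2 freeSurface,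
    ∀ f, ∀ᵐ x ∂(volume.restrict freeSurface), S f x = f x := by
  refine exists_clm_of_eLpNorm_le (fun f => f) (fun f => (Lp.aestronglyMeasurable f).restrict)
    (fun f => eLpNorm_mono_measure _ Measure.restrict_le_self)
    (fun f g => ae_restrict_of_ae (Lp.coeFn_add f g))
    (fun c f => ae_restrict_of_ae (Lp.coeFn_smul c f))

/-- On ℰ the weight x⁻² is smaller than |x|⁻¹, so the norm is at most that of the isometry f ↦ x⁻¹
f(1/x). -/
theorem exists_clm_inversion : ∃ S : Lp ℂ 2 (volume : Measure ℝ) →L[ℂ] L2 freeSurface,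
    ∀ f, ∀ᵐ x ∂(volume.restrict freeSurface), S f x = (1 / (x : ℂ) ^ 2) * f (1 / x) := by
  refine exists_clm_of_eLpNorm_le (fun f x => (1 / (x : ℂ) ^ 2) * f (1 / x)) (fun f => ?_)
    (fun f => ?_) (fun f g => ae_restrict_of_ae ?_) (fun c f => ae_restrict_of_ae ?_)
  · refine AEStronglyMeasurable.restrict ?_
    exact AEStronglyMeasurable.mul (Measurable.aestronglyMeasurable (by fun_prop))
      ((Lp.aestronglyMeasurable f).comp_quasiMeasurePreserving quasiMeasurePreserving_one_div)
  · rw [← eLpNorm_inversion f]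
    refine (eLpNorm_mono_ae ?_).trans (eLpNorm_mono_measure _ Measure.restrict_le_self)
    filter_upwards [ae_restrict_mem measurableSet_freeSurface] with x hx
    have hx : 1 < |x| := hx
    rw [norm_mul, norm_mul]
    gcongr
    rw [norm_div, norm_div, norm_pow, Complex.norm_real, norm_one, Real.norm_eq_abs]
    gcongr
    nlinarith
  · filter_upwards [ae_comp_one_div (Lp.coeFn_add f g)] with x hx
    rw [hx, Pi.add_apply]; ring
  · filter_upwards [ae_comp_one_div (Lp.coeFn_smul c f)] with x hx
    rw [hx, Pi.smul_apply, smul_eq_mul]; ring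

theorem memLp_one_div : MemLp (fun x : ℝ => 1 / ((Real.pi : ℂ) * (x : ℂ))) 2
    (volume.restrict freeSurface) := by
  have hm : Measurable fun x : ℝ => 1 / ((Real.pi : ℂ) * (x : ℂ)) := by fun_prop
  refine (memLp_two_iff_integrable_sq_norm hm.aestronglyMeasurable).2 ?_
  refine ((integrable_poisson one_pos 0).const_mul (2 / Real.pi ^ 2)).integrableOn.mono'
    (hm.norm.pow_const 2).aestronglyMeasurable ?_
  filter_upwards [ae_restrict_mem measurableSet_freeSurface] with x hx
  have hx : 1 < |x| := hx
  have hx2 : 1 < x ^ 2 := by rw [← sq_abs]; nlinarith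
  have hp := Real.pi_pos
  rw [Real.norm_of_nonneg (by positivity), norm_div, norm_mul, Complex.norm_real, Complex.norm_real,
    norm_one, div_pow, mul_pow, Real.norm_eq_abs, Real.norm_eq_abs, sq_abs, sq_abs, one_pow,
    div_mul_div_comm, div_le_div_iff₀ (by positivity) (by positivity)]
  nlinarith [sq_nonneg Real.pi, mul_pos hp hp]

/-! ### The operator defined by the formula -/

theorem truncatedHilbert_congr {f g : ℝ → ℂ} (h : f =ᵐ[volume] g) :
    truncatedHilbert f = truncatedHilbert g := by
  funext x ε
  unfold truncatedHilbert
  congr 1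
  refine integral_congr_ae (ae_restrict_of_ae ?_)
  filter_upwards [h] with t ht
  rw [ht]

theorem hilbertTransform_eq_of_tendsto {f : ℝ → ℂ} {x : ℝ} {y : ℂ}
    (h : Tendsto (truncatedHilbert f x) (𝓝[>] 0) (𝓝 y)) : hilbertTransform f x = y :=
  h.limUnder_eq

/-- The principal value of `f ∈ L²(ℝ)` exists almost everywhere. -/
theorem ae_hilbertExistsAt {f : ℝ → ℂ} (hf : MemLp f 2 volume) : ∀ᵐ x : ℝ, HilbertExistsAt f x := by
  filter_upwards [tendsto_truncatedHilbert (hf.toLp f)] with x hx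
  rw [truncatedHilbert_congr hf.coeFn_toLp] at hx
  exact ⟨_, hx⟩

/-- The extended Dirichlet-to-Neumann operator, given by its explicit formula. -/
theorem exists_lambdaOmega : ∃ Λ : W12 freeSurface →L[ℂ] L2 freeSurface,
    ∀ (v : W12 freeSurface) (w : ℝ → ℂ), IsContRep v w →
      ∀ᵐ x ∂(volume.restrict freeSurface),
        Λ v x = - hilbertTransform (gExt v) x
          - (1 / (x : ℂ) ^ 2) * hilbertTransform (gExt v) (1 / x)
          - (w 1 - w (-1)) / ((Real.pi : ℂ) * (x : ℂ)) := by
  obtain ⟨X, hX⟩ := exists_clm_extend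
  obtain ⟨R, hR⟩ := exists_clm_restrict
  obtain ⟨J, hJ⟩ := exists_clm_inversion
  obtain ⟨T, hT⟩ := exists_clm_trace_sub
  -- Differentiate, extend by zero and apply ℋ; then `R` restricts to ℰ and `J` gives the reflected
  -- term. The rank-one operator carries the jump v(1) - v(-1).
  refine ⟨-((R + J) ∘L hilbertCLM ∘L X ∘L weakDerivCLM freeSurface)
    - T.smulRight (memLp_one_div.toLp _), fun v w hw => ?_⟩
  set G := hilbertCLM (X (weakDeriv v)) with hG
  have hHG : ∀ᵐ x : ℝ, G x = hilbertTransform (gExt v) x := by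
    filter_upwards [tendsto_truncatedHilbert (X (weakDeriv v))] with x hx
    rw [truncatedHilbert_congr (hX (weakDeriv v))] at hx
    exact (hilbertTransform_eq_of_tendsto hx).symm
  have e : (-((R + J) ∘L hilbertCLM ∘L X ∘L weakDerivCLM freeSurface)
      - T.smulRight (memLp_one_div.toLp _)) v
      = -(R G + J G) - (w 1 - w (-1)) • (memLp_one_div.toLp _) := by
    rw [← hT v w hw]; rfl
  rw [e]
  filter_upwards [Lp.coeFn_sub (-(R G + J G)) ((w 1 - w (-1)) • (memLp_one_div.toLp _)),
    Lp.coeFn_neg (R G + J G), Lp.coeFn_add (R G) (J G), hR G, hJ G,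
    Lp.coeFn_smul (w 1 - w (-1)) (memLp_one_div.toLp _), memLp_one_div.coeFn_toLp,
    ae_restrict_of_ae hHG, ae_restrict_of_ae (ae_comp_one_div hHG)] with x h1 h2 h3 h4 h5 h6 h7 h8 h9
  rw [h1, Pi.sub_apply, h2, Pi.neg_apply, h3, Pi.add_apply, h4, h5, h6, Pi.smul_apply, h7, h8, h9,
    smul_eq_mul]
  ring

/-! ### The extension η(v) for v in V₀(ℰ) -/

/-- The inner part `-t⁻² v'(1/t)` of the derivative of `η(v)`. -/
noncomputable def hExt (v : W12 freeSurface) (t : ℝ) : ℂ := -(1 / (t : ℂ) ^ 2) * gExt v (1 / t)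

theorem gExt_of_abs_le_one (v : W12 freeSurface) {t : ℝ} (ht : |t| ≤ 1) : gExt v t = 0 :=
  Set.indicator_of_notMem (s := freeSurface) (fun h => absurd ht (not_le.2 h)) _

theorem abs_one_div_le_one {t : ℝ} (ht : 1 ≤ |t|) : |1 / t| ≤ 1 := by
  rw [abs_div, abs_one]; exact (div_le_one (by linarith)).2 ht

theorem hExt_of_one_le_abs (v : W12 freeSurface) {t : ℝ} (ht : 1 ≤ |t|) : hExt v t = 0 := by
  rw [hExt, gExt_of_abs_le_one v (abs_one_div_le_one ht), mul_zero]

/-- An element of `V₀(ℰ)` and its weak derivative vanish outside a large interval. -/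
theorem MemV0.exists_radius {v : W12 freeSurface} (h : MemV0 v) : ∃ R : ℝ, 1 < R ∧
    (∀ᵐ x : ℝ, R < |x| → valFn v x = 0) ∧ ∀ᵐ x : ℝ, R < |x| → gExt v x = 0 := by
  obtain ⟨K, hK, hv⟩ := h
  obtain ⟨R, hR⟩ := hK.isBounded.subset_closedBall 0
  have h1 : ∀ x : ℝ, max R 2 < |x| → x ∈ freeSurface := fun x hx =>
    show 1 < |x| by linarith [le_max_right R 2]
  have hv0 : ∀ᵐ x : ℝ, max R 2 < |x| → valFn v x = 0 := by
    filter_upwards [(ae_restrict_iff' measurableSet_freeSurface).1 hv] with x hx hxR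
    refine hx (h1 x hxR) fun hxK => ?_
    have := hR hxK
    rw [mem_closedBall_zero_iff, Real.norm_eq_abs] at this
    linarith [le_max_left R 2]
  refine ⟨max R 2, by linarith [le_max_right R 2], hv0, ?_⟩
  have hV : IsOpen {x : ℝ | max R 2 < |x|} := isOpen_lt continuous_const continuous_abs
  filter_upwards [weakDeriv_ae_eq_zero measurableSet_freeSurface hV h1 v hv0] with x hx hxR
  rw [gExt, Set.indicator_of_mem (h1 x hxR)]
  exact hx hxR

/-- This function is the isometric inversion of -s g(s). The factor s is harmless because g vanishes
beyond `R`; here compact support matters. -/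
theorem memLp_hExt {v : W12 freeSurface} {R : ℝ}
    (hR : ∀ᵐ x : ℝ, R < |x| → gExt v x = 0) : MemLp (hExt v) 2 volume := by
  have hm : MemLp (fun s : ℝ => -(s : ℂ) * gExt v s) 2 volume := by
    refine ((memLp_gExt v).const_mul (R : ℂ)).of_le
      (AEStronglyMeasurable.mul (Measurable.aestronglyMeasurable (by fun_prop)) (memLp_gExt v).1) ?_
    filter_upwards [hR] with s hs
    by_cases h : R < |s|
    · simp [hs h]
    · rw [norm_mul, norm_mul, norm_neg, Complex.norm_real, Complex.norm_real, Real.norm_eq_abs]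
      gcongr
      exact (not_lt.1 h).trans (Real.le_norm_self R)
  refine (memLp_inversion hm).ae_eq (Eventually.of_forall fun t => ?_)
  simp only [hExt]
  push_cast
  ring

/-- Substitution s = 1/t; endpoints of the same sign keep the interval away from 0. -/
theorem intervalIntegral_hExt (v : W12 freeSurface) {a b : ℝ} (h : 0 < a * b) :
    ∫ t in a..b, hExt v t = ∫ s in (1 / a)..(1 / b), gExt v s := by
  have h0 : ∀ x ∈ Set.uIcc a b, x ≠ 0 := by
    rintro x hx rfl
    rw [Set.mem_uIcc] at hx
    rcases hx with ⟨h1, h2⟩ | ⟨h1, h2⟩ <;> nlinarith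
  have := intervalIntegral.integral_deriv_smul_comp_of_deriv_nonpos (f := fun x : ℝ => x⁻¹)
    (f' := fun x => -(x ^ 2)⁻¹) (g := gExt v) (a := a) (b := b)
    (fun x hx => (hasDerivAt_inv (h0 x hx)).continuousAt.continuousWithinAt)
    (fun x hx => hasDerivAt_inv (h0 x (Set.Ioo_subset_Icc_self hx)))
    (fun x _ => neg_nonpos.2 (by positivity))
  rw [one_div, one_div, ← this]
  refine intervalIntegral.integral_congr fun t _ => ?_
  simp only [hExt, Function.comp_apply, Complex.real_smul, one_div]
  push_cast; rfl

/-- Some point just beyond ±R is a zero of `w`, and since g vanishes between them the value at ±R is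
the same. -/
theorem IsContRep.eq_zero {v : W12 freeSurface} {w : ℝ → ℂ} (hw : IsContRep v w) {R : ℝ}
    (hR : 1 < R) (hv : ∀ᵐ x : ℝ, R < |x| → valFn v x = 0)
    (hg : ∀ᵐ x : ℝ, R < |x| → gExt v x = 0) : w R = 0 ∧ w (-R) = 0 := by
  have hii := intervalIntegrable_of_locallyIntegrable (locallyIntegrable_gExt v)
  have hae : ∀ᵐ x : ℝ, R < |x| → w x = 0 := by
    filter_upwards [hv, (ae_restrict_iff' measurableSet_freeSurface).1 hw.ae_eq] with x h1 h2 hx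
    rw [← h2 (show 1 < |x| by linarith), h1 hx]
  constructor
  · obtain ⟨x, hx, hxR⟩ : ∃ x, w x = 0 ∧ x ∈ Set.Ioo R (R + 1) := by
      have hfr : ∃ᶠ x in ae (volume : Measure ℝ), x ∈ Set.Ioo R (R + 1) := by
        rw [frequently_ae_mem_iff]; simp
      obtain ⟨x, h1, h2⟩ := (hfr.and_eventually hae).exists
      exact ⟨x, h2 (lt_of_lt_of_le h1.1 (le_abs_self x)), h1⟩
    have e : ∫ t in R..x, gExt v t = 0 := by
      refine intervalIntegral.integral_zero_ae ?_
      filter_upwards [hg] with t ht htm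
      rw [Set.uIoc_of_le hxR.1.le] at htm
      exact ht (lt_of_lt_of_le htm.1 (le_abs_self t))
    have h1 := hw.right x (by linarith [hxR.1])
    rw [← intervalIntegral.integral_add_adjacent_intervals (hii 1 R) (hii R x), e, add_zero,
      ← hw.right R hR.le, hx] at h1
    exact h1.symm
  · obtain ⟨x, hx, hxR⟩ : ∃ x, w x = 0 ∧ x ∈ Set.Ioo (-R - 1) (-R) := by
      have hfr : ∃ᶠ x in ae (volume : Measure ℝ), x ∈ Set.Ioo (-R - 1) (-R) := by
        rw [frequently_ae_mem_iff]; simp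
      obtain ⟨x, h1, h2⟩ := (hfr.and_eventually hae).exists
      exact ⟨x, h2 (lt_of_lt_of_le (by linarith [h1.2]) (neg_le_abs x)), h1⟩
    have e : ∫ t in (-R)..x, gExt v t = 0 := by
      refine intervalIntegral.integral_zero_ae ?_
      have hne : ∀ᵐ t : ℝ, t ≠ -R := by simp [ae_iff]
      filter_upwards [hg, hne] with t ht htR htm
      rw [Set.uIoc_of_ge hxR.2.le] at htm
      exact ht (lt_of_lt_of_le (by linarith [lt_of_le_of_ne htm.2 htR]) (neg_le_abs t))
    have h1 := hw.left x (by linarith [hxR.2])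
    rw [← intervalIntegral.integral_add_adjacent_intervals (hii (-1) (-R)) (hii (-R) x), e, add_zero,
      ← hw.left (-R) (by linarith), hx] at h1
    exact h1.symm

/-- Each half-line contributes only its endpoint at ±1, since `w` vanishes at ±R. This is the source
of the 1/(πx) term. -/
theorem integral_gExt {v : W12 freeSurface} {w : ℝ → ℂ} (hw : IsContRep v w) {R : ℝ}
    (hR : 1 < R) (hv : ∀ᵐ x : ℝ, R < |x| → valFn v x = 0)
    (hg : ∀ᵐ x : ℝ, R < |x| → gExt v x = 0) :
    Integrable (gExt v) ∧ ∫ t, gExt v t = w (-1) - w 1 := by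
  have hloc := locallyIntegrable_gExt v
  have hii := intervalIntegrable_of_locallyIntegrable hloc
  have hind : gExt v =ᵐ[volume] (Set.Icc (-R) R).indicator (gExt v) := by
    filter_upwards [hg] with x hx
    by_cases h : x ∈ Set.Icc (-R) R
    · rw [Set.indicator_of_mem h]
    · rw [Set.indicator_of_notMem h]
      refine hx (not_le.1 fun hle => h ?_)
      exact abs_le.1 hle
  refine ⟨((integrable_indicator_iff measurableSet_Icc).2
    (hloc.integrableOn_isCompact isCompact_Icc)).congr hind.symm, ?_⟩
  rw [integral_congr_ae hind, integral_indicator measurableSet_Icc, integral_Icc_eq_integral_Ioc,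
    ← intervalIntegral.integral_of_le (by linarith),
    ← intervalIntegral.integral_add_adjacent_intervals (hii (-R) (-1)) (hii (-1) R),
    ← intervalIntegral.integral_add_adjacent_intervals (hii (-1) 1) (hii 1 R)]
  have h0 : ∫ t in (-1 : ℝ)..1, gExt v t = 0 := by
    refine intervalIntegral.integral_zero_ae (Eventually.of_forall fun t ht => ?_)
    rw [Set.uIoc_of_le (by norm_num)] at ht
    exact gExt_of_abs_le_one v (abs_le.2 ⟨ht.1.le, ht.2⟩)
  obtain ⟨hp, hn⟩ := hw.eq_zero hR hv hg
  have h1 := hw.right R hR.le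
  have h2 := hw.left (-R) (by linarith)
  rw [intervalIntegral.integral_symm] at h2
  rw [h0]
  rw [hp] at h1
  rw [hn] at h2
  linear_combination -h1 + h2

/-- For `v ∈ V₀(ℰ)`, the function `η(v)` is an indefinite integral. -/
theorem eta_ae_eq_primitive {v : W12 freeSurface} {w : ℝ → ℂ} (hw : IsContRep v w) {R : ℝ}
    (hR : 1 < R) (hv : ∀ᵐ x : ℝ, R < |x| → valFn v x = 0)
    (hg : ∀ᵐ x : ℝ, R < |x| → gExt v x = 0) :
    ∀ᵐ x : ℝ, eta (valFn v) x = 0 + ∫ t in (0 : ℝ)..x, (gExt v t + hExt v t) := by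
  have hF : LocallyIntegrable fun t => gExt v t + hExt v t :=
    ((memLp_gExt v).add (memLp_hExt hg)).locallyIntegrable (by norm_num)
  have hii := intervalIntegrable_of_locallyIntegrable hF
  have hR0 : 0 < R := by linarith
  have hR1 : 1 / R < 1 := (div_lt_one hR0).2 hR
  have hRp : 0 < 1 / R := by positivity
  obtain ⟨hp, hn⟩ := hw.eq_zero hR hv hg
  -- Near 0 the point 1/t lies beyond the support, so the primitive based at 0 can be started at
  -- ±1/R.
  have hz : ∀ᵐ t : ℝ, |t| < 1 / R → gExt v t + hExt v t = 0 := by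
    have hne : ∀ᵐ t : ℝ, t ≠ 0 := by simp [ae_iff]
    filter_upwards [ae_comp_one_div hg, hne] with t ht ht0 htR
    rw [gExt_of_abs_le_one v (htR.trans hR1).le, hExt, ht, mul_zero, add_zero]
    rw [abs_div, abs_one]
    rw [lt_div_iff₀ hR0] at htR
    rw [lt_div_iff₀ (abs_pos.2 ht0)]
    linarith
  have hout : ∀ a b : ℝ, (∀ t ∈ Set.uIcc a b, 1 ≤ |t|) →
      ∫ t in a..b, (gExt v t + hExt v t) = ∫ t in a..b, gExt v t := fun a b h =>
    intervalIntegral.integral_congr fun t ht => by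
      simp only [hExt_of_one_le_abs v (h t ht), add_zero]
  have hin : ∀ a b : ℝ, (∀ t ∈ Set.uIcc a b, |t| ≤ 1) →
      ∫ t in a..b, (gExt v t + hExt v t) = ∫ t in a..b, hExt v t := fun a b h =>
    intervalIntegral.integral_congr fun t ht => by
      simp only [gExt_of_abs_le_one v (h t ht), zero_add]
  have hinR : ∀ x : ℝ, 0 < x → x ≤ 1 →
      w (1 / x) = w 1 + ∫ t in (1 : ℝ)..x, (gExt v t + hExt v t) := by
    intro x hx hx1
    rw [hin 1 x, intervalIntegral_hExt v (by simpa using hx), div_one]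
    · exact hw.right _ ((one_le_div hx).2 hx1)
    · intro t ht
      rw [Set.uIcc_of_ge hx1] at ht
      exact abs_le.2 ⟨by linarith [ht.1], ht.2⟩
  have hinL : ∀ x : ℝ, x < 0 → -1 ≤ x →
      w (1 / x) = w (-1) + ∫ t in (-1 : ℝ)..x, (gExt v t + hExt v t) := by
    intro x hx hx1
    rw [hin (-1) x, intervalIntegral_hExt v (by linarith), div_neg, div_one]
    · refine hw.left _ ?_
      rw [div_le_iff_of_neg hx]
      linarith
    · intro t ht
      rw [Set.uIcc_of_le hx1] at ht
      exact abs_le.2 ⟨ht.1, by linarith [ht.2]⟩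
  -- Following the inner part from 1/R, where the reflected value `w R` is zero, up to 1 recovers
  -- the trace. One primitive then serves both sides of ±1.
  have hw1 : w 1 = ∫ t in (0 : ℝ)..1, (gExt v t + hExt v t) := by
    have h1 := hinR (1 / R) hRp hR1.le
    rw [one_div_one_div, hp, intervalIntegral.integral_symm] at h1
    have h2 : ∫ t in (0 : ℝ)..(1 / R), (gExt v t + hExt v t) = 0 := by
      refine intervalIntegral.integral_zero_ae ?_
      have hne : ∀ᵐ t : ℝ, t ≠ 1 / R := by simp [ae_iff]
      filter_upwards [hz, hne] with t ht htR htm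
      rw [Set.uIoc_of_le hRp.le] at htm
      exact ht (by rw [abs_of_pos htm.1]; exact lt_of_le_of_ne htm.2 htR)
    rw [← intervalIntegral.integral_add_adjacent_intervals (hii 0 (1 / R)) (hii (1 / R) 1), h2]
    linear_combination -h1
  have hwn1 : w (-1) = ∫ t in (0 : ℝ)..(-1), (gExt v t + hExt v t) := by
    have h1 := hinL (-(1 / R)) (by linarith) (by linarith)
    have e : 1 / -(1 / R) = -R := by rw [div_neg, one_div_one_div]
    rw [e, hn, intervalIntegral.integral_symm] at h1
    have h2 : ∫ t in (0 : ℝ)..(-(1 / R)), (gExt v t + hExt v t) = 0 := by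
      refine intervalIntegral.integral_zero_ae ?_
      have hne : ∀ᵐ t : ℝ, t ≠ 0 := by simp [ae_iff]
      filter_upwards [hz, hne] with t ht ht0 htm
      rw [Set.uIoc_of_ge (by linarith)] at htm
      exact ht (by rw [abs_of_neg (lt_of_le_of_ne htm.2 ht0)]; linarith [htm.1])
    rw [← intervalIntegral.integral_add_adjacent_intervals (hii 0 (-(1 / R))) (hii (-(1 / R)) (-1)),
      h2]
    linear_combination -h1
  have hwE := (ae_restrict_iff' measurableSet_freeSurface).1 hw.ae_eq
  have hne0 : ∀ᵐ t : ℝ, t ≠ 0 := by simp [ae_iff]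
  have hne1 : ∀ᵐ t : ℝ, t ≠ 1 := by simp [ae_iff]
  have hne2 : ∀ᵐ t : ℝ, t ≠ -1 := by simp [ae_iff]
  filter_upwards [hwE, ae_comp_one_div hwE, hne0, hne1, hne2] with x h1 h2 hx0 hx1 hxn1
  rw [zero_add, eta]
  split_ifs with hx
  · rw [h1 hx]
    rcases lt_abs.1 hx with h | h
    · rw [← intervalIntegral.integral_add_adjacent_intervals (hii 0 1) (hii 1 x), ← hw1, hout 1 x]
      · exact hw.right x h.le
      · intro t ht
        rw [Set.uIcc_of_le h.le] at ht
        exact ht.1.trans (le_abs_self t)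
    · have h' : x ≤ -1 := by linarith
      rw [← intervalIntegral.integral_add_adjacent_intervals (hii 0 (-1)) (hii (-1) x), ← hwn1,
        hout (-1) x]
      · exact hw.left x h'
      · intro t ht
        rw [Set.uIcc_of_ge h'] at ht
        exact le_trans (by linarith [ht.2]) (neg_le_abs t)
  · have hxa : |x| < 1 := by
      refine lt_of_le_of_ne (not_lt.1 hx) fun h => ?_
      rcases eq_or_eq_neg_of_abs_eq h with h | h
      · exact hx1 h
      · exact hxn1 h
    have hE : 1 / x ∈ freeSurface := by
      change 1 < |1 / x|
      rw [abs_div, abs_one]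
      exact (one_lt_div (abs_pos.2 hx0)).2 hxa
    rw [h2 hE]
    rcases lt_or_gt_of_ne hx0 with h | h
    · rw [hinL x h (abs_le.1 hxa.le).1, hwn1,
        intervalIntegral.integral_add_adjacent_intervals (hii 0 (-1)) (hii (-1) x)]
    · rw [hinR x h (abs_le.1 hxa.le).2, hw1,
        intervalIntegral.integral_add_adjacent_intervals (hii 0 1) (hii 1 x)]

/-- The inner part v(1/x) is the isometric inversion of s⁻¹ v(s), and |s⁻¹| ≤ 1 on ℰ. Compact
support is not needed here. -/
theorem memLp_eta (v : W12 freeSurface) : MemLp (eta (valFn v)) 2 volume := by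
  have h1 := memLp_indicator_L2 measurableSet_freeSurface (valFn v)
  have h2 : MemLp (fun s : ℝ => (1 / (s : ℂ)) * freeSurface.indicator (valFn v) s) 2 volume := by
    refine h1.of_le (AEStronglyMeasurable.mul (Measurable.aestronglyMeasurable (by fun_prop)) h1.1)
      (Eventually.of_forall fun s => ?_)
    by_cases hs : s ∈ freeSurface
    · rw [norm_mul, norm_div, norm_one, Complex.norm_real]
      have hs : 1 < |s| := hs
      refine mul_le_of_le_one_left (norm_nonneg _) ?_
      rw [Real.norm_eq_abs]
      exact (div_le_one (by linarith)).2 hs.le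
    · simp [Set.indicator_of_notMem hs]
  have hne1 : ∀ᵐ t : ℝ, t ≠ 1 := by simp [ae_iff]
  have hne2 : ∀ᵐ t : ℝ, t ≠ -1 := by simp [ae_iff]
  refine (h1.add (memLp_inversion h2)).ae_eq ?_
  filter_upwards [hne1, hne2] with x hx1 hxn1
  rw [Pi.add_apply, eta]
  split_ifs with hx hx0
  · have : 1 / x ∉ freeSurface := fun h : 1 < |1 / x| =>
      absurd (abs_one_div_le_one hx.le) (not_le.2 h)
    rw [Set.indicator_of_mem (show x ∈ freeSurface from hx), Set.indicator_of_notMem this]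
    ring
  · subst hx0
    have : (0 : ℝ) ∉ freeSurface := fun h => hx h
    simp [Set.indicator_of_notMem this]
  · have hxa : |x| < 1 := by
      refine lt_of_le_of_ne (not_lt.1 hx) fun h => ?_
      rcases eq_or_eq_neg_of_abs_eq h with h | h
      · exact hx1 h
      · exact hxn1 h
    have hE : 1 / x ∈ freeSurface := by
      change 1 < |1 / x|
      rw [abs_div, abs_one]
      exact (one_lt_div (abs_pos.2 hx0)).2 hxa
    rw [Set.indicator_of_notMem (show x ∉ freeSurface from hx), Set.indicator_of_mem hE]
    have : (x : ℂ) ≠ 0 := by exact_mod_cast hx0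
    push_cast
    field_simp
    ring

/-- For `v ∈ V₀(ℰ)`, the function `η(v)` belongs to `W^{1,2}(ℝ)`. -/
theorem MemV0.exists_eta {v : W12 freeSurface} (h : MemV0 v) :
    ∃ u : W12 Set.univ, (∀ᵐ x : ℝ, valFn u x = eta (valFn v) x) ∧
      ∀ᵐ x : ℝ, weakDeriv u x = gExt v x + hExt v x := by
  obtain ⟨R, hR, hv, hg⟩ := h.exists_radius
  obtain ⟨w, hw⟩ := exists_isContRep v
  have hη := eta_ae_eq_primitive hw hR hv hg
  have m1 : MemLp (eta (valFn v)) 2 (volume.restrict Set.univ) := (memLp_eta v).restrict _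
  have m2 : MemLp (fun x => gExt v x + hExt v x) 2 (volume.restrict Set.univ) :=
    ((memLp_gExt v).add (memLp_hExt hg)).restrict _
  have hF : LocallyIntegrable fun t => gExt v t + hExt v t :=
    ((memLp_gExt v).add (memLp_hExt hg)).locallyIntegrable (by norm_num)
  have a1 : ∀ᵐ x : ℝ, m1.toLp _ x = eta (valFn v) x := ae_of_ae_restrict_univ m1.coeFn_toLp
  have a2 : ∀ᵐ x : ℝ, m2.toLp _ x = gExt v x + hExt v x := ae_of_ae_restrict_univ m2.coeFn_toLp
  have hwd : IsWeakDeriv Set.univ (m1.toLp _) (m2.toLp _) := by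
    intro φ hφ hφc _
    rw [setIntegral_univ, setIntegral_univ]
    have h1 := integral_const_add_primitive_mul_deriv hF (hφ.of_le (by simp)) hφc 0 0
    have h2 : ∫ x, m2.toLp _ x * φ x = ∫ x, (gExt v x + hExt v x) * φ x :=
      integral_congr_ae (by filter_upwards [a2] with x hx; rw [hx])
    rw [h2, ← h1]
    refine integral_congr_ae ?_
    filter_upwards [a1, hη] with x h1 h2
    rw [h1, h2]
  exact ⟨⟨WithLp.toLp 2 (m1.toLp _, m2.toLp _), hwd⟩, a1, a2⟩

/-! ### The formula on V₀(ℰ) -/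

/-- Once ε < δ the truncation removes only points where `f` is zero, so the truncated integral is
already constant in ε. -/
theorem tendsto_truncatedHilbert_of_eq_zero {f : ℝ → ℂ} {x δ : ℝ} (hδ : 0 < δ)
    (h : ∀ t, |x - t| < δ → f t = 0) :
    Tendsto (truncatedHilbert f x) (𝓝[>] 0)
      (𝓝 ((1 / (Real.pi : ℂ)) * ∫ t, f t / ((x : ℂ) - (t : ℂ)))) := by
  refine tendsto_const_nhds.congr' ?_
  filter_upwards [Ioo_mem_nhdsGT hδ] with ε hε
  rw [truncatedHilbert, setIntegral_eq_integral_of_forall_compl_eq_zero]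
  intro t ht
  have ht : ¬ ε ≤ |x - t| := ht
  rw [h t ((not_le.1 ht).trans hε.2), zero_div]

/-- The Hilbert transform on `ℰ` of the inner part of the derivative of `η(v)`. -/
theorem tendsto_truncatedHilbert_hExt {v : W12 freeSurface} {w : ℝ → ℂ} (hw : IsContRep v w)
    {R : ℝ} (hR : 1 < R) (hv : ∀ᵐ x : ℝ, R < |x| → valFn v x = 0)
    (hg : ∀ᵐ x : ℝ, R < |x| → gExt v x = 0) {x : ℝ} (hx : x ∈ freeSurface) :
    Tendsto (truncatedHilbert (hExt v) x) (𝓝[>] 0)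
      (𝓝 ((1 / (x : ℂ) ^ 2) * hilbertTransform (gExt v) (1 / x)
        + (w 1 - w (-1)) / ((Real.pi : ℂ) * (x : ℂ)))) := by
  have hx : 1 < |x| := hx
  have hx0 : x ≠ 0 := fun h => by rw [h, abs_zero] at hx; linarith
  have hxC : (x : ℂ) ≠ 0 := by exact_mod_cast hx0
  have hpi : (Real.pi : ℂ) ≠ 0 := by simp [Real.pi_ne_zero]
  have hix : |1 / x| < 1 := by rw [abs_div, abs_one]; exact (div_lt_one (by linarith)).2 hx
  obtain ⟨hgi, hgint⟩ := integral_gExt hw hR hv hg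
  have hδ : 0 < 1 - |1 / x| := by linarith
  -- The distance from 1/x to ±1 is at least 1 - |1/x|, and g vanishes on [-1, 1].
  have hgz : ∀ t, |1 / x - t| < 1 - |1 / x| → gExt v t = 0 := by
    intro t ht
    refine gExt_of_abs_le_one v ?_
    have := abs_sub_abs_le_abs_sub t (1 / x)
    rw [abs_sub_comm] at this
    linarith
  have hH := hilbertTransform_eq_of_tendsto (tendsto_truncatedHilbert_of_eq_zero hδ hgz)
  have hki : Integrable fun s => gExt v s / (((1 / x : ℝ) : ℂ) - (s : ℂ)) := by
    have hs : MeasurableSet {t : ℝ | 1 - |1 / x| ≤ |1 / x - t|} :=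
      measurableSet_le measurable_const (by fun_prop)
    refine ((integrable_indicator_iff hs).2 (integrable_truncated (memLp_gExt v) (1 / x) hδ)).congr
      (Eventually.of_forall fun t => ?_)
    by_cases ht : 1 - |1 / x| ≤ |1 / x - t|
    · simp only [Set.indicator_of_mem (show t ∈ {t : ℝ | 1 - |1 / x| ≤ |1 / x - t|} from ht)]
    · simp only [Set.indicator_of_notMem (show t ∉ {t : ℝ | 1 - |1 / x| ≤ |1 / x - t|} from ht),
        hgz t (not_le.1 ht), zero_div]
  have hδ' : 0 < |x| - 1 := by linarith
  have hhz : ∀ t, |x - t| < |x| - 1 → hExt v t = 0 := by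
    intro t ht
    refine hExt_of_one_le_abs v ?_
    have := abs_sub_abs_le_abs_sub x t
    linarith
  -- With s = 1/t the kernel becomes -s/(xs - 1), and division with remainder splits it as -1/x +
  -- x⁻²/(1/x - s). The constant part produces ∫ g.
  have key : ∫ t, hExt v t / ((x : ℂ) - (t : ℂ))
      = -(1 / (x : ℂ)) * (w (-1) - w 1)
        + (1 / (x : ℂ) ^ 2) * ∫ s, gExt v s / (((1 / x : ℝ) : ℂ) - (s : ℂ)) := by
    rw [← hgint, ← integral_const_mul, ← integral_const_mul,
      ← integral_add (hgi.const_mul _) (hki.const_mul _),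
      ← integral_comp_one_div fun s => -(1 / (x : ℂ)) * gExt v s
        + (1 / (x : ℂ) ^ 2) * (gExt v s / (((1 / x : ℝ) : ℂ) - (s : ℂ)))]
    refine integral_congr_ae ?_
    have hne0 : ∀ᵐ t : ℝ, t ≠ 0 := by simp [ae_iff]
    filter_upwards [hne0] with t ht0
    by_cases hz : gExt v (1 / t) = 0
    · simp only [hExt, hz, mul_zero, zero_div, add_zero]
    have ht1 : |t| < 1 := by
      by_contra hcon
      exact hz (gExt_of_abs_le_one v (abs_one_div_le_one (not_lt.1 hcon)))
    have hxt : (x : ℂ) - t ≠ 0 := by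
      intro h
      have : x = t := by exact_mod_cast sub_eq_zero.1 h
      rw [this] at hx; linarith
    have htC : (t : ℂ) ≠ 0 := by exact_mod_cast ht0
    have e : (((1 / x : ℝ) : ℂ) - ((1 / t : ℝ) : ℂ)) = (t - x) / (x * t) := by
      push_cast; field_simp
    rw [e, hExt]
    generalize gExt v (1 / t) = γ
    have e2 : (t : ℂ) - x = -(x - t) := by ring
    rw [e2]
    field_simp
    ring
  have hlim := tendsto_truncatedHilbert_of_eq_zero hδ' hhz
  rw [key] at hlim
  rw [hH]
  convert hlim using 2
  field_simp
  ring

theorem MemV0.isLambdaOmega {v : W12 freeSurface} (h : MemV0 v) {w : ℝ → ℂ} (hw : IsContRep v w)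
    {f : L2 freeSurface} (hf : ∀ᵐ x ∂(volume.restrict freeSurface),
      f x = - hilbertTransform (gExt v) x - (1 / (x : ℂ) ^ 2) * hilbertTransform (gExt v) (1 / x)
        - (w 1 - w (-1)) / ((Real.pi : ℂ) * (x : ℂ))) :
    IsLambdaOmega v f := by
  obtain ⟨u, hu1, hu2⟩ := h.exists_eta
  obtain ⟨R, hR, hv, hg⟩ := h.exists_radius
  refine ⟨u, hu1, ?_⟩
  filter_upwards [hf, ae_restrict_of_ae (ae_hilbertExistsAt (memLp_gExt v)),
    ae_restrict_mem measurableSet_freeSurface] with x hfx ⟨y, hy⟩ hx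
  have hh := tendsto_truncatedHilbert_hExt hw hR hv hg hx
  have hsum : Tendsto (truncatedHilbert (weakDeriv u) x) (𝓝[>] 0) (𝓝 (y +
      ((1 / (x : ℂ) ^ 2) * hilbertTransform (gExt v) (1 / x)
        + (w 1 - w (-1)) / ((Real.pi : ℂ) * (x : ℂ))))) := by
    rw [truncatedHilbert_congr hu2]
    refine (hy.add hh).congr' ?_
    filter_upwards [self_mem_nhdsWithin] with ε hε
    have hε : 0 < ε := hε
    simp only [truncatedHilbert]
    rw [← mul_add, ← integral_add (integrable_truncated (memLp_gExt v) x hε)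
      (integrable_truncated (memLp_hExt hg) x hε)]
    simp_rw [add_div]
  refine ⟨⟨_, hsum⟩, ?_⟩
  rw [lambdaH, hilbertTransform_eq_of_tendsto hsum, hfx, hilbertTransform_eq_of_tendsto hy]
  ring

/-- η(v) fixes the weak derivative almost everywhere, and truncated integrals see nothing finer. Two
bounded extensions therefore agree on V₀(ℰ). -/
theorem IsLambdaOmega.unique {v : W12 freeSurface} {f₁ f₂ : L2 freeSurface}
    (h₁ : IsLambdaOmega v f₁) (h₂ : IsLambdaOmega v f₂) : f₁ = f₂ := by
  obtain ⟨u₁, hu₁, hf₁⟩ := h₁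
  obtain ⟨u₂, hu₂, hf₂⟩ := h₂
  have hd : ∀ᵐ x : ℝ, weakDeriv u₁ x = weakDeriv u₂ x := weakDeriv_congr u₁ u₂ (by
    filter_upwards [hu₁, hu₂] with x h1 h2
    rw [h1, h2])
  have hH : hilbertTransform (weakDeriv u₁) = hilbertTransform (weakDeriv u₂) := by
    funext x
    rw [hilbertTransform, hilbertTransform, truncatedHilbert_congr hd]
  refine Lp.ext ?_
  filter_upwards [hf₁, hf₂] with x h1 h2
  rw [h1.2, h2.2, lambdaH, lambdaH, hH]

end FloatingDisk

/-! ### Extension, uniqueness by density, and the formula -/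

open FloatingDisk
theorem mainTheorem4 :
    ∃ Λ : W12 freeSurface →L[ℂ] L2 freeSurface,
      -- `Λ` extends `Λ_Ω` from `V₀(ℰ)`, and is the only bounded operator that does
      (∀ v : W12 freeSurface, MemV0 v → IsLambdaOmega v (Λ v)) ∧
      (∀ Λ' : W12 freeSurface →L[ℂ] L2 freeSurface,
        (∀ v : W12 freeSurface, MemV0 v → IsLambdaOmega v (Λ' v)) → Λ' = Λ) ∧
      -- the formula; `w` is the representative of `v` that is continuous up to `±1`
      ∀ v : W12 freeSurface, ∃ w : ℝ → ℂ,
        ContinuousOn w {x : ℝ | 1 ≤ |x|} ∧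
        (∀ᵐ x ∂(volume.restrict freeSurface), valFn v x = w x) ∧
        ∀ᵐ x ∂(volume.restrict freeSurface),
          HilbertExistsAt (gExt v) x ∧ HilbertExistsAt (gExt v) (1 / x) ∧
          Λ v x = - hilbertTransform (gExt v) x
            - (1 / (x : ℂ) ^ 2) * hilbertTransform (gExt v) (1 / x)
            - (w 1 - w (-1)) / ((Real.pi : ℂ) * (x : ℂ)) := by
  obtain ⟨Λ, hΛ⟩ := exists_lambdaOmega
  have hext : ∀ v : W12 freeSurface, MemV0 v → IsLambdaOmega v (Λ v) := fun v hv => by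
    obtain ⟨w, hw⟩ := exists_isContRep v
    exact hv.isLambdaOmega hw (hΛ v w hw)
  refine ⟨Λ, hext, fun Λ' hΛ' => ?_, fun v => ?_⟩
  · ext1 v
    obtain ⟨u, hu, hlim⟩ := exists_seq_memV0_tendsto v
    refine tendsto_nhds_unique ((Λ'.continuous.tendsto v).comp hlim) ?_
    refine ((Λ.continuous.tendsto v).comp hlim).congr fun n => ?_
    exact (hext _ (hu n)).unique (hΛ' _ (hu n))
  · obtain ⟨w, hw⟩ := exists_isContRep v
    refine ⟨w, hw.continuousOn, hw.ae_eq, ?_⟩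
    have hex := ae_hilbertExistsAt (memLp_gExt v)
    filter_upwards [hΛ v w hw, ae_restrict_of_ae hex, ae_restrict_of_ae (ae_comp_one_div hex)]
      with x h1 h2 h3
    exact ⟨h2, h3, h1⟩
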